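/- Let $m>0$, $\alpha,\gamma\in\mathbb R$, let $p\ge 1$, $C_f>0$, and let $f\in C(\mathbb C,\mathbb C)$ satisfy $f(0)=0$ and $$|f(z)-f(w)|\le C_f\,(1+|z|^{p-1}+|w|^{p-1})\,|z-w|\qquad (z,w\in\mathbb C)$$ (for instance $f(u)=|u|^{p-1}u$ with $p>1$). Let $\mathcal H=H^1(\mathbb R;\mathbb C)\times L^2(\mathbb R;\mathbb C)$, regarded as a real Hilbert space with $\|(u,v)\|_{\mathcal H}^2=\|u'\|_{L^2}^2+\|u\|_{L^2}^2+\|v\|_{L^2}^2$. Let $\mathcal A(u,v)=(v,\,u''-m^2u)$, where $u''$ is taken on $\mathbb R\setminus\{0\}$, with domain $$\mathfrak D=\{(u,v): u\in H^1(\mathbb R)\cap H^2(\mathbb R\setminus\{0\}),\ v\in H^1(\mathbb R),\ u'(0^+)-u'(0^-)=\gamma u(0)+i\alpha v(0)\},$$ and let $F(u,v)=(0,f(u))$. Then $f(u)\in L^2$ for every $u\in H^1$, so that $F$ maps $\mathcal H$ to $\mathcal H$, and $\mathcal A$ generates a unique strongly continuous semigroup $(e^{t\mathcal A})_{t\ge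 0}$ on $\mathcal H$. For $U_0\in\mathcal H$ consider the mild (Duhamel) form $$U(t)=e^{t\mathcal A}U_0+\int_0^t e^{(t-s)\mathcal A}F(U(s))\,ds \qquad(\ast)$$ of the Klein–Gordon equation with delta potentials $u_{tt}-u_{xx}+m^2u+\gamma\delta u+i\alpha\delta u_t-f(u)=0$, $(u,u_t)|_{t=0}=U_0$, where $U=(u,u_t)$. There exists a function $T:\mathcal H\to(0,\infty]$ such that for every $U_0\in\mathcal H$ there is $U\in C([0,T(U_0)),\mathcal H)$ which satisfies $(\ast)$ for all $t\in[0,T(U_0))$ and which, for every $0<\tau<T(U_0)$, is on $[0,\tau]$ the unique solution of $(\ast)$ in $C([0,\tau],\mathcal H)$. Furthermore, the blow-up alternative holds: if $T(U_0)<\infty$, then $\lim_{t\uparrow T(U_0)}\|U(t)\|_{\mathcal H}=\infty$. -/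

import Mathlib

open MeasureTheory Filter Topology Set
open scoped NNReal ENNReal ContDiff

noncomputable section

namespace DeltaKG

/-- `L²(ℝ; ℂ)`. -/
abbrev L2 : Type := Lp ℂ 2 (volume : Measure ℝ)

/-- `g` is the weak derivative of `f` on the open set `Ω ⊆ ℝ`
(the functions in `L²` are locally integrable, so both integrals below converge). -/
def HasWeakDerivOn (Ω : Set ℝ) (f g : L2) : Prop :=
  ∀ φ : ℝ → ℝ, ContDiff ℝ ∞ φ → HasCompactSupport φ → tsupport φ ⊆ Ω →
    ∫ x, deriv φ x • f x = - ∫ x, φ x • g x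

theorem integrable_smul_L2 (ψ : ℝ → ℝ) (hc : Continuous ψ) (hs : HasCompactSupport ψ) (f : L2) :
    Integrable (fun x => ψ x • f x) volume :=
  memLp_one_iff_integrable.1 <|
    (Lp.memLp f).smul (hc.memLp_of_hasCompactSupport (p := 2) hs)

theorem continuous_integral_smul_L2 (ψ : ℝ → ℝ) (hc : Continuous ψ) (hs : HasCompactSupport ψ) :
    Continuous (fun f : L2 => ∫ x, ψ x • f x) := by
  have hm : MemLp (fun x => (ψ x : ℂ)) 2 volume :=
    (Complex.continuous_ofReal.comp hc).memLp_of_hasCompactSupport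
      (hs.comp_left (g := ((↑) : ℝ → ℂ)) Complex.ofReal_zero)
  have key : (fun f : L2 => ∫ x, ψ x • f x) = fun f : L2 => inner ℂ (hm.toLp _) f := by
    funext f
    rw [L2.inner_def]
    refine integral_congr_ae ?_
    filter_upwards [hm.coeFn_toLp] with x hx
    rw [hx]
    simp [mul_comm]
  rw [key]
  fun_prop

/-- The Sobolev space `H¹(ℝ; ℂ)`, as the real Hilbert space of all pairs `(u, u')` of functions in
`L²` such that `u'` is the weak derivative of `u` on `ℝ`. Since `u` determines `u'`, a pair is the
same as its first component; the norm is `(‖u‖² + ‖u'‖²)^(1/2)`. -/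
def H1 : Submodule ℝ (WithLp 2 (L2 × L2)) where
  carrier := {w | HasWeakDerivOn univ w.fst w.snd}
  zero_mem' := by
    intro φ _ _ _
    have h : ∀ ψ : ℝ → ℝ, ∫ x, ψ x • (0 : L2) x = 0 := by
      intro ψ
      rw [← integral_zero ℝ ℂ]
      refine integral_congr_ae ?_
      filter_upwards [Lp.coeFn_zero ℂ 2 (volume : Measure ℝ)] with x hx
      rw [hx]
      simp
    change ∫ x, deriv φ x • (0 : L2) x = - ∫ x, φ x • (0 : L2) x
    rw [h, h, neg_zero]
  add_mem' := by
    intro a b ha hb φ h1 h2 h3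
    have h : ∀ ψ : ℝ → ℝ, Continuous ψ → HasCompactSupport ψ → ∀ f g : L2,
        ∫ x, ψ x • (f + g) x = (∫ x, ψ x • f x) + ∫ x, ψ x • g x := by
      intro ψ hc hs f g
      rw [← integral_add (integrable_smul_L2 ψ hc hs f) (integrable_smul_L2 ψ hc hs g)]
      refine integral_congr_ae ?_
      filter_upwards [Lp.coeFn_add f g] with x hx
      rw [hx, Pi.add_apply, smul_add]
    have hd : Continuous (deriv φ) := h1.continuous_deriv (by simp)
    have ha' := ha φ h1 h2 h3
    have hb' := hb φ h1 h2 h3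
    change ∫ x, deriv φ x • (a.fst + b.fst) x = - ∫ x, φ x • (a.snd + b.snd) x
    rw [h _ hd h2.deriv, h _ h1.continuous h2, ha', hb', neg_add]
  smul_mem' := by
    intro c a ha φ h1 h2 h3
    have h : ∀ (ψ : ℝ → ℝ) (f : L2), ∫ x, ψ x • (c • f) x = c • ∫ x, ψ x • f x := by
      intro ψ f
      rw [← integral_smul]
      refine integral_congr_ae ?_
      filter_upwards [Lp.coeFn_smul c f] with x hx
      rw [hx, Pi.smul_apply, smul_comm]
    change ∫ x, deriv φ x • (c • a.fst) x = - ∫ x, φ x • (c • a.snd) x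
    rw [h, h, ha φ h1 h2 h3, smul_neg]

/-- `H¹` is closed in `L² × L²`, hence complete; in particular Bochner integrals with values in the
energy space below have their usual meaning. -/
instance instCompleteSpaceH1 : CompleteSpace H1 := by
  have hcl : IsClosed (H1 : Set (WithLp 2 (L2 × L2))) := by
    have : (H1 : Set (WithLp 2 (L2 × L2))) =
        ⋂ (φ : ℝ → ℝ) (_ : ContDiff ℝ ∞ φ) (_ : HasCompactSupport φ) (_ : tsupport φ ⊆ univ),
          {w | ∫ x, deriv φ x • w.fst x = - ∫ x, φ x • w.snd x} := by
      ext w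
      simp only [mem_iInter]
      rfl
    rw [this]
    refine isClosed_iInter fun φ => isClosed_iInter fun h1 => isClosed_iInter fun h2 =>
      isClosed_iInter fun _ => isClosed_eq ?_ ?_
    · exact (continuous_integral_smul_L2 _ (h1.continuous_deriv (by simp)) h2.deriv).comp
        (WithLp.prod_continuous_ofLp 2 L2 L2).fst
    · exact ((continuous_integral_smul_L2 _ h1.continuous h2).comp
        (WithLp.prod_continuous_ofLp 2 L2 L2).snd).neg
  exact hcl.completeSpace_coe

/-- The underlying `L²` function of an element of `H¹`. -/
def fn (u : H1) : L2 := u.1.fst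

/-- The weak derivative of an element of `H¹`. -/
def wderiv (u : H1) : L2 := u.1.snd

/-- The energy space `H¹ × L²`, a real Hilbert space with
`‖(u, v)‖² = ‖u'‖² + ‖u‖² + ‖v‖²` (all norms on the right being those of `L²`). -/
abbrev Energy : Type := WithLp 2 (H1 × L2)

/-- `c` is the value at `0` of the continuous representative of `u`. -/
def HasValueAtZero (u : L2) (c : ℂ) : Prop :=
  ∃ g : ℝ → ℂ, u =ᵐ[volume] g ∧ Continuous g ∧ g 0 = c

/-- `u` has a representative, continuous on `ℝ ∖ {0}`, with the one-sided limits
`a = u(0⁻)` and `b = u(0⁺)`. -/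
def HasOneSidedValues (u : L2) (a b : ℂ) : Prop :=
  ∃ g : ℝ → ℂ, u =ᵐ[volume] g ∧ ContinuousOn g {0}ᶜ ∧
    Tendsto g (𝓝[<] 0) (𝓝 a) ∧ Tendsto g (𝓝[>] 0) (𝓝 b)

/-- The domain `𝔇`: all `(u, v)` with `u ∈ H¹(ℝ) ∩ H²(ℝ ∖ {0})`, `v ∈ H¹(ℝ)` and
`u'(0⁺) - u'(0⁻) = γ u(0) + i α v(0)`. -/
def domain (γ α : ℝ) : Set Energy :=
  {U | (∃ u'' : L2, HasWeakDerivOn {0}ᶜ (wderiv U.fst) u'') ∧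
    (∃ w : H1, fn w = U.snd) ∧
    ∃ a b c d : ℂ, HasOneSidedValues (wderiv U.fst) a b ∧
      HasValueAtZero (fn U.fst) c ∧ HasValueAtZero U.snd d ∧
      b - a = γ * c + Complex.I * α * d}

/-- The graph of the operator `𝒜 (u, v) = (v, u'' - m² u)` with domain `𝔇`, where `u''` is the weak
second derivative of `u` on `ℝ ∖ {0}`: a pair `(U, W)` belongs to it when `U ∈ 𝔇` and `W = 𝒜 U`. -/
def generatorGraph (m γ α : ℝ) : Set (Energy × Energy) :=
  {P | P.1 ∈ domain γ α ∧ fn P.2.fst = P.1.snd ∧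
    ∃ u'' : L2, HasWeakDerivOn {0}ᶜ (wderiv P.1.fst) u'' ∧ P.2.snd = u'' - (m ^ 2) • fn P.1.fst}

/-- `S` is the strongly continuous semigroup on the Banach space `X` generated by the operator with
graph `A`: the pairs of `A` are exactly the `(x, y)` with `y = lim_{h → 0⁺} (S(h) x - x) / h`. -/
structure IsSemigroupGeneratedBy {X : Type*} [NormedAddCommGroup X] [NormedSpace ℝ X]
    (S : ℝ≥0 → X →L[ℝ] X) (A : Set (X × X)) : Prop where
  map_zero : S 0 = ContinuousLinearMap.id ℝ X
  map_add : ∀ s t, S (s + t) = (S s).comp (S t)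
  continuous_orbit : ∀ x, Continuous fun t => S t x
  generator : ∀ x y, (x, y) ∈ A ↔
    Tendsto (fun h : ℝ≥0 => (h : ℝ)⁻¹ • (S h x - x)) (𝓝[>] 0) (𝓝 y)

open Classical in
/-- The map `F(u, v) = (0, f(u))` on the energy space. (The value `0` in the second case is only
there to make `F` total; it is irrelevant when `f(u) ∈ L²` for all `u ∈ H¹`.) -/
def nonlinearity (f : ℂ → ℂ) (U : Energy) : Energy :=
  WithLp.toLp 2 ((0 : H1),
    if h : MemLp (fun x => f (fn U.fst x)) 2 volume then h.toLp _ else (0 : L2))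

/-- `U ∈ C(I, H¹ × L²)` is a mild solution on the time interval `I ∋ 0`, `I ⊆ [0, ∞)`:
`U(t) = S(t) U₀ + ∫₀ᵗ S(t - s) F(U(s)) ds` for all `t ∈ I`. -/
def IsMildSolution (S : ℝ≥0 → Energy →L[ℝ] Energy) (f : ℂ → ℂ) (U₀ : Energy) (I : Set ℝ)
    (U : ℝ → Energy) : Prop :=
  ContinuousOn U I ∧ ∀ t ∈ I,
    U t = S t.toNNReal U₀ + ∫ s in (0 : ℝ)..t, S (t - s).toNNReal (nonlinearity f (U s))

end DeltaKG

end

/-! The proof has a linear part, the generation of the semigroup, and an abstract fixed-point part.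

The difficulty of the linear part is the jump condition, which couples `u(0)` and `v(0)`.
Integrating by parts on each half-line, one sees that `W = 𝒜 U` holds exactly when `W₁ = v` and
`(u', φ') + (W₂ + m² u, φ) + ⟨γ u(0) + iα v(0), φ(0)⟩ = 0` for all `φ ∈ H¹`. The jump thus becomes a
natural boundary condition (`generatorGraph_eq`).

Now take `φ = v`. For the real inner product `⟨iα v(0), v(0)⟩ = 0`, so the energy `E(U, U) = ‖u'‖² +
M‖u‖² + γ|u(0)|² + ‖v‖²` satisfies `E(U, 𝒜 U) = (M - m²)(u, v)`. If `M` is large, the trace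
inequality makes `E` equivalent to the squared norm, and `𝒜` is quasi-dissipative. The resolvent
equation reduces to a coercive problem for `u` alone, solved by Lax–Milgram
(`isQuasiDissipative_weakGraph`). These facts give resolvent power bounds and a dense domain, whence
the semigroup by Hille–Yosida (`IsHilleYosidaResolvent.exists_semigroup`); its generator determines
it (`IsSemigroupGeneratedBy.unique`).

For the nonlinear part, the embedding of `H¹` into bounded functions makes `F` Lipschitz on balls
(`norm_nonlinearity_sub_le`). A contraction argument gives mild solutions on a time interval whose
length depends only on the size of the datum, Gronwall gives uniqueness, and `T` is the supremum of
the existence times. If `T` is finite and the norm does not tend to infinity, it lies below a fixed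
bound at times arbitrarily close to `T`; restarting at such a time leads past `T`
(`IsSemilinear.exists_maximal`). -/

namespace DeltaKG

/-! ### Strongly continuous semigroups: joint continuity and uniqueness. -/

section Semigroup

variable {X : Type*} [NormedAddCommGroup X] [NormedSpace ℝ X]

/-- A locally bounded, strongly continuous family of operators is jointly continuous. -/
theorem continuous_uncurry_of_locally_bounded {S : ℝ≥0 → X →L[ℝ] X}
    (hc : ∀ x, Continuous fun t => S t x) (hb : ∀ T, ∃ M, ∀ t ≤ T, ‖S t‖ ≤ M) :
    Continuous fun q : ℝ≥0 × X => S q.1 q.2 := by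
  rw [continuous_iff_continuousAt]
  rintro ⟨t, x⟩
  obtain ⟨M, hM⟩ := hb (t + 1)
  have hM0 : 0 ≤ M := (norm_nonneg _).trans (hM 0 (by simp))
  have h1 : Tendsto (fun q : ℝ≥0 × X => S q.1 x) (𝓝 (t, x)) (𝓝 (S t x)) :=
    (((hc x).comp continuous_fst).tendsto (t, x))
  have h2 : Tendsto (fun q : ℝ≥0 × X => S q.1 (q.2 - x)) (𝓝 (t, x)) (𝓝 0) := by
    have h3 : Tendsto (fun q : ℝ≥0 × X => M * ‖q.2 - x‖) (𝓝 (t, x)) (𝓝 0) := by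
      have : Continuous (fun q : ℝ≥0 × X => M * ‖q.2 - x‖) := by fun_prop
      simpa using this.tendsto (t, x)
    refine squeeze_zero_norm' ?_ h3
    have h4 : ∀ᶠ q : ℝ≥0 × X in 𝓝 (t, x), q.1 < t + 1 :=
      continuous_fst.continuousAt.eventually_lt continuousAt_const (by simp)
    filter_upwards [h4] with q hq
    exact (S q.1).le_of_opNorm_le (hM _ hq.le) _
  have h5 := h1.add h2
  rw [add_zero] at h5
  refine h5.congr fun q => ?_
  simp

namespace IsSemigroupGeneratedBy

variable {S : ℝ≥0 → X →L[ℝ] X} {A : Set (X × X)}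

/-- Each orbit is bounded on the compact interval `[0, T]`, so the uniform boundedness principle
applies. -/
theorem locally_bounded [CompleteSpace X] (h : IsSemigroupGeneratedBy S A) (T : ℝ≥0) :
    ∃ M, ∀ t ≤ T, ‖S t‖ ≤ M := by
  obtain ⟨M, hM⟩ := banach_steinhaus (g := fun t : Icc (0 : ℝ≥0) T => S t) (by
    intro x
    obtain ⟨C, hC⟩ := (isCompact_Icc (a := (0 : ℝ≥0)) (b := T)).exists_bound_of_continuousOn
      (h.continuous_orbit x).continuousOn
    exact ⟨C, fun t => hC t t.2⟩)
  exact ⟨M, fun t ht => hM ⟨t, bot_le, ht⟩⟩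

theorem continuous_uncurry [CompleteSpace X] (h : IsSemigroupGeneratedBy S A) :
    Continuous fun q : ℝ≥0 × X => S q.1 q.2 :=
  continuous_uncurry_of_locally_bounded h.continuous_orbit h.locally_bounded

/-- `S t` commutes with the difference quotients at `0`. Hence orbits starting in the domain stay in
it, and the generator commutes with `S t` there. -/
theorem apply_mem (h : IsSemigroupGeneratedBy S A) {x y : X} (hxy : (x, y) ∈ A) (t : ℝ≥0) :
    (S t x, S t y) ∈ A := by
  rw [h.generator] at hxy ⊢
  refine (((S t).continuous.tendsto y).comp hxy).congr fun k => ?_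
  have : S t (S k x) = S k (S t x) := by
    rw [← ContinuousLinearMap.comp_apply, ← ContinuousLinearMap.comp_apply, ← h.map_add,
      ← h.map_add, add_comm]
  simp [this]

end IsSemigroupGeneratedBy

theorem tendsto_toNNReal_sub (s : ℝ) :
    Tendsto (fun r : ℝ => (r - s).toNNReal) (𝓝[>] s) (𝓝[>] 0) := by
  refine tendsto_nhdsWithin_iff.2 ⟨?_, ?_⟩
  · have : Continuous fun r : ℝ => (r - s).toNNReal := by fun_prop
    simpa using (this.tendsto s).mono_left nhdsWithin_le_nhds
  · filter_upwards [self_mem_nhdsWithin] with r hr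
    simpa using hr

/-- A semigroup is determined by its generator. -/
theorem IsSemigroupGeneratedBy.unique [CompleteSpace X] {S S' : ℝ≥0 → X →L[ℝ] X} {A : Set (X × X)}
    (h : IsSemigroupGeneratedBy S A) (h' : IsSemigroupGeneratedBy S' A)
    (hd : Dense {x | ∃ y, (x, y) ∈ A}) : S' = S := by
  have hS := h.continuous_uncurry
  funext t
  ext z
  refine congrFun (Continuous.ext_on hd (S' t).continuous (S t).continuous ?_) z
  rintro x ⟨y, hxy⟩
  -- The curve `s ↦ S (t - s) (S' s x)` joins `S t x` to `S' t x`. Its right derivative vanishes,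
  -- because `S' s x` lies in the domain and both semigroups have the same derivative there.
  have hcont : Continuous fun s : ℝ => S ((t : ℝ) - s).toNNReal (S' s.toNNReal x) :=
    hS.comp ((continuous_real_toNNReal.comp (continuous_const.sub continuous_id)).prodMk
      ((h'.continuous_orbit x).comp continuous_real_toNNReal))
  have hder : ∀ s ∈ Ico (0 : ℝ) t, HasDerivWithinAt
      (fun s : ℝ => S ((t : ℝ) - s).toNNReal (S' s.toNNReal x)) 0 (Ici s) s := by
    intro s hs
    rw [hasDerivWithinAt_iff_tendsto_slope, Ici_sdiff_left]
    have hmem := h'.apply_mem hxy s.toNNReal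
    have e1 := ((h.generator _ _).1 hmem).comp (tendsto_toNNReal_sub s)
    have e2 := ((h'.generator _ _).1 hmem).comp (tendsto_toNNReal_sub s)
    have e3 := e2.sub e1
    rw [sub_self] at e3
    have e4 : Tendsto (fun r : ℝ => ((t : ℝ) - r).toNNReal) (𝓝[>] s) (𝓝 ((t : ℝ) - s).toNNReal) := by
      have : Continuous fun r : ℝ => ((t : ℝ) - r).toNNReal := by fun_prop
      exact (this.tendsto s).mono_left nhdsWithin_le_nhds
    have e5 := (hS.tendsto (((t : ℝ) - s).toNNReal, (0 : X))).comp (e4.prodMk_nhds e3)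
    rw [_root_.map_zero] at e5
    refine e5.congr' ?_
    have : ∀ᶠ r in 𝓝[>] s, r ∈ Ioo s (t : ℝ) := Ioo_mem_nhdsGT hs.2
    filter_upwards [this] with r hr
    have hr0 : (0 : ℝ) ≤ r - s := by linarith [hr.1]
    have a1 : r.toNNReal = (r - s).toNNReal + s.toNNReal := by
      rw [← Real.toNNReal_add hr0 hs.1]; simp
    have a2 : ((t : ℝ) - s).toNNReal = ((t : ℝ) - r).toNNReal + (r - s).toNNReal := by
      rw [← Real.toNNReal_add (by linarith [hr.2]) hr0]; simp
    simp only [Function.comp_apply, slope_def_module]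
    rw [a1, a2, h'.map_add, h.map_add]
    simp [Real.coe_toNNReal _ hr0, smul_sub]
  have := constant_of_has_deriv_right_zero hcont.continuousOn hder t ⟨t.2, le_rfl⟩
  simpa [h.map_zero, h'.map_zero] using this

end Semigroup

/-! ### The Hille–Yosida theorem by Yosida approximation. -/

section HilleYosida

variable {X : Type*} [NormedAddCommGroup X] [NormedSpace ℝ X]

/-- `R l`, `l > b`, are the resolvents of the operator with graph `A`, with the power bounds of the
Hille–Yosida theorem. -/
structure IsHilleYosidaResolvent (A : Submodule ℝ (X × X)) (b C : ℝ) (R : ℝ → X →L[ℝ] X) :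
    Prop where
  nonneg : 0 ≤ b
  mem : ∀ l > b, ∀ z, (R l z, l • R l z - z) ∈ A
  left_inv : ∀ l > b, ∀ x y, (x, y) ∈ A → R l (l • x - y) = x
  bound : ∀ l > b, ∀ n : ℕ, ‖R l ^ n‖ ≤ C / (l - b) ^ n
  dense : Dense {x | ∃ y, (x, y) ∈ A}

/-- The Yosida approximation of an operator with resolvents `R`. -/
noncomputable def yosida (R : ℝ → X →L[ℝ] X) (l : ℝ) : X →L[ℝ] X := l ^ 2 • R l - l • 1

namespace IsHilleYosidaResolvent

variable {A : Submodule ℝ (X × X)} {b C : ℝ} {R : ℝ → X →L[ℝ] X}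

theorem const_nonneg (h : IsHilleYosidaResolvent A b C R) : 0 ≤ C := by
  have := h.bound (b + 1) (by linarith) 0
  simp only [pow_zero, div_one] at this
  exact (norm_nonneg _).trans this

/-- This is the resolvent identity `(l - k) R l R k = R k - R l`, read in both orders. -/
theorem commute (h : IsHilleYosidaResolvent A b C R) {l k : ℝ} (hl : b < l) (hk : b < k) :
    Commute (R l) (R k) := by
  rcases eq_or_ne l k with rfl | hne
  · exact Commute.refl _
  have key : ∀ {l k : ℝ}, b < l → b < k → ∀ z, (l - k) • R l (R k z) = R k z - R l z := by
    intro l k hl hk z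
    have := h.left_inv l hl _ _ (h.mem k hk z)
    have h2 : R l (l • R k z - (k • R k z - z)) = (l - k) • R l (R k z) + R l z := by
      simp [sub_smul]; abel
    rw [h2] at this
    exact eq_sub_of_add_eq this
  ext z
  have h1 := key hl hk z
  have h2 := key hk hl z
  have h3 : (l - k) • R l (R k z) = (l - k) • R k (R l z) := by
    rw [h1, ← neg_sub k l, neg_smul, h2]; abel
  exact smul_right_injective X (sub_ne_zero.2 hne) h3

theorem yosida_commute (h : IsHilleYosidaResolvent A b C R) {l k : ℝ} (hl : b < l) (hk : b < k) :
    Commute (yosida R l) (yosida R k) := by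
  unfold yosida
  have := h.commute hl hk
  refine Commute.sub_left (Commute.sub_right ?_ ?_) (Commute.sub_right ?_ ?_)
  · exact (this.smul_left _).smul_right _
  · exact ((Commute.one_right _).smul_left _).smul_right _
  · exact ((Commute.one_left _).smul_left _).smul_right _
  · exact ((Commute.one_left _).smul_left _).smul_right _

/-- On the domain the approximation is `l R l` applied to the image under the operator; since `l R
l` tends strongly to the identity, it converges to the operator. -/
theorem yosida_apply (h : IsHilleYosidaResolvent A b C R) {l : ℝ} (hl : b < l) {x y : X}
    (hxy : (x, y) ∈ A) : yosida R l x = l • R l y := by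
  have h1 := h.left_inv l hl x y hxy
  rw [map_sub, map_smul] at h1
  have h2 : R l y = l • R l x - x := by nth_rw 2 [← h1]; abel
  rw [h2]
  simp [yosida, smul_sub, smul_smul, sq]

/-- Split off the scalar factor `exp (-t l)` and sum the power bounds in the exponential series. The
exponents add up to `t b l / (l - b)`, and `l / (l - b) ≤ 2` once `l ≥ 2 b`, so the bound is uniform
in `l`. -/
theorem norm_exp_yosida_le [CompleteSpace X] (h : IsHilleYosidaResolvent A b C R) {l : ℝ} (hl : b < l)
    (hl2 : 2 * b ≤ l) {t : ℝ} (ht : 0 ≤ t) :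
    ‖NormedSpace.exp (t • yosida R l)‖ ≤ C * Real.exp (2 * b * t) := by
  have hpos : 0 < l - b := by linarith
  have hl0 : 0 < l := lt_of_le_of_lt h.nonneg hl
  have e1 : t • yosida R l = (t * l ^ 2) • R l + (-(t * l)) • (1 : X →L[ℝ] X) := by
    simp [yosida, smul_smul, sub_eq_add_neg]
  have e2 : NormedSpace.exp (t • yosida R l)
      = Real.exp (-(t * l)) • NormedSpace.exp ((t * l ^ 2) • R l) := by
    let : NormedAlgebra ℚ (X →L[ℝ] X) := NormedAlgebra.restrictScalars ℚ ℝ _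
    rw [e1, NormedSpace.exp_add_of_commute ((Commute.one_right _).smul_right _)]
    have : NormedSpace.exp ((-(t * l)) • (1 : X →L[ℝ] X)) = Real.exp (-(t * l)) • 1 := by
      rw [← Algebra.algebraMap_eq_smul_one, ← Algebra.algebraMap_eq_smul_one,
        Real.exp_eq_exp_ℝ, NormedSpace.algebraMap_exp_comm]
    rw [this]; simp
  have e3 : ‖NormedSpace.exp ((t * l ^ 2) • R l)‖ ≤ C * Real.exp (t * l ^ 2 / (l - b)) := by
    have hs : HasSum (fun n : ℕ => C * ((n.factorial : ℝ)⁻¹ • (t * l ^ 2 / (l - b)) ^ n))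
        (C * Real.exp (t * l ^ 2 / (l - b))) := by
      rw [Real.exp_eq_exp_ℝ]
      exact (NormedSpace.exp_series_hasSum_exp' (𝕂 := ℝ) (t * l ^ 2 / (l - b))).mul_left C
    have hs2 := NormedSpace.exp_series_hasSum_exp' (𝕂 := ℝ) ((t * l ^ 2) • R l)
    rw [← hs2.tsum_eq]
    refine tsum_of_norm_bounded hs fun n => ?_
    rw [smul_pow, norm_smul, norm_smul, Real.norm_of_nonneg (by positivity),
      Real.norm_of_nonneg (by positivity), smul_eq_mul, div_pow]
    calc (n.factorial : ℝ)⁻¹ * ((t * l ^ 2) ^ n * ‖R l ^ n‖)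
        ≤ (n.factorial : ℝ)⁻¹ * ((t * l ^ 2) ^ n * (C / (l - b) ^ n)) := by
          gcongr
          exact h.bound l hl n
      _ = _ := by ring
  rw [e2, norm_smul, Real.norm_of_nonneg (Real.exp_pos _).le]
  calc Real.exp (-(t * l)) * ‖NormedSpace.exp ((t * l ^ 2) • R l)‖
      ≤ Real.exp (-(t * l)) * (C * Real.exp (t * l ^ 2 / (l - b))) := by gcongr
    _ = C * Real.exp (-(t * l) + t * l ^ 2 / (l - b)) := by rw [Real.exp_add]; ring
    _ ≤ C * Real.exp (2 * b * t) := by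
      have := h.const_nonneg
      gcongr
      have e4 : -(t * l) + t * l ^ 2 / (l - b) = t * b * (l / (l - b)) := by field_simp; ring
      have e5 : l / (l - b) ≤ 2 := by rw [div_le_iff₀ hpos]; linarith
      rw [e4]
      have := mul_le_mul_of_nonneg_left e5 (mul_nonneg ht h.nonneg)
      linarith

end IsHilleYosidaResolvent

/-- Strong convergence on a dense set of an eventually bounded family of operators implies strong
convergence. -/
theorem tendsto_apply_of_dense {ι : Type*} {l : Filter ι} {T : ι → X →L[ℝ] X} {L : X →L[ℝ] X}
    {M : ℝ} (hM : ∀ᶠ i in l, ‖T i‖ ≤ M) {D : Set X} (hD : Dense D)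
    (h : ∀ x ∈ D, Tendsto (fun i => T i x) l (𝓝 (L x))) (z : X) :
    Tendsto (fun i => T i z) l (𝓝 (L z)) := by
  rw [Metric.tendsto_nhds]
  intro ε hε
  have hK : 0 < |M| + ‖L‖ + 1 := by positivity
  obtain ⟨x, hxD, hx⟩ := Metric.dense_iff.1 hD z (ε / 2 / (|M| + ‖L‖ + 1)) (by positivity)
  rw [Metric.mem_ball, dist_comm, dist_eq_norm, lt_div_iff₀ hK] at hxD
  filter_upwards [hM, Metric.tendsto_nhds.1 (h x hx) (ε / 2) (by positivity)] with i hi hi2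
  rw [dist_eq_norm] at hi2 ⊢
  have e : T i z - L z = T i (z - x) + (T i x - L x) - L (z - x) := by simp
  have n1 : ‖T i (z - x)‖ ≤ |M| * ‖z - x‖ := (T i).le_of_opNorm_le (hi.trans (le_abs_self M)) _
  have n2 : ‖L (z - x)‖ ≤ ‖L‖ * ‖z - x‖ := L.le_opNorm _
  have n3 : ‖T i z - L z‖ ≤ ‖T i (z - x)‖ + ‖T i x - L x‖ + ‖L (z - x)‖ := by
    rw [e]; exact (norm_sub_le _ _).trans (by gcongr; exact norm_add_le _ _)
  nlinarith [norm_nonneg (z - x)]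

theorem hasDerivAt_exp_smul_apply [CompleteSpace X] (B : X →L[ℝ] X) (x : X) (t : ℝ) :
    HasDerivAt (fun t : ℝ => NormedSpace.exp (t • B) x) (NormedSpace.exp (t • B) (B x)) t := by
  have h := hasDerivAt_exp_smul_const (𝕂 := ℝ) B t
  simpa using h.clm_apply (hasDerivAt_const t x)

namespace IsHilleYosidaResolvent

variable {A : Submodule ℝ (X × X)} {b C : ℝ} {R : ℝ → X →L[ℝ] X}

/-- On the domain `l R l x - x = R l y = O(1 / l)`; the uniform bound `2 C` on `l R l` extends the
convergence to the whole space. -/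
theorem tendsto_smul_apply (h : IsHilleYosidaResolvent A b C R) (z : X) :
    Tendsto (fun l : ℝ => l • R l z) atTop (𝓝 z) := by
  have hC := h.const_nonneg
  have hb := h.nonneg
  have h1 : ∀ l : ℝ, 2 * b + 1 ≤ l → ‖R l‖ ≤ C / (l - b) := fun l hl => by
    simpa using h.bound l (by linarith) 1
  refine tendsto_apply_of_dense (T := fun l : ℝ => l • R l) (L := 1) (M := 2 * C) ?_ h.dense ?_ z
  · filter_upwards [eventually_ge_atTop (2 * b + 1)] with l hl
    have h2 : 0 < l - b := by linarith
    rw [norm_smul, Real.norm_of_nonneg (by linarith)]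
    calc l * ‖R l‖ ≤ l * (C / (l - b)) := by
          gcongr
          · linarith
          · exact h1 l hl
      _ ≤ 2 * C := by
          rw [← mul_div_assoc, div_le_iff₀ h2]
          nlinarith
  · rintro x ⟨y, hxy⟩
    have h3 : Tendsto (fun l : ℝ => C / (l - b) * ‖y‖) atTop (𝓝 0) := by
      have : Tendsto (fun l : ℝ => C / (l - b)) atTop (𝓝 0) :=
        (tendsto_atTop_add_const_right _ (-b) tendsto_id).const_div_atTop C
      simpa using this.mul_const ‖y‖
    rw [tendsto_iff_norm_sub_tendsto_zero]
    refine squeeze_zero' (Eventually.of_forall fun _ => norm_nonneg _) ?_ h3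
    filter_upwards [eventually_ge_atTop (2 * b + 1)] with l hl
    have h4 := h.left_inv l (by linarith) x y hxy
    rw [map_sub, map_smul] at h4
    have h5 : (l • R l) x - (1 : X →L[ℝ] X) x = R l y := by
      change l • R l x - x = _
      nth_rw 2 [← h4]
      abel
    rw [h5]
    exact (R l).le_of_opNorm_le (h1 l hl) y

theorem tendsto_yosida_apply (h : IsHilleYosidaResolvent A b C R) {x y : X} (hxy : (x, y) ∈ A) :
    Tendsto (fun l : ℝ => yosida R l x) atTop (𝓝 y) := by
  refine (h.tendsto_smul_apply y).congr' ?_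
  filter_upwards [eventually_gt_atTop b] with l hl
  exact (h.yosida_apply hl hxy).symm

variable [CompleteSpace X]

/-- Interpolate by `s ↦ exp ((t - s) B) (exp (s B') x)`. Because `B` and `B'` commute, its
derivative is the product of the two exponentials applied to `B' x - B x`. -/
theorem norm_exp_yosida_sub_le (h : IsHilleYosidaResolvent A b C R) {l k : ℝ}
    (hl : 2 * b + 1 ≤ l) (hk : 2 * b + 1 ≤ k) {t : ℝ} (ht : 0 ≤ t) (x : X) :
    ‖NormedSpace.exp (t • yosida R k) x - NormedSpace.exp (t • yosida R l) x‖
      ≤ (C * Real.exp (2 * b * t)) * (C * Real.exp (2 * b * t)) *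
        ‖yosida R k x - yosida R l x‖ * t := by
  have hb := h.nonneg
  have hcomm := h.yosida_commute (l := l) (k := k) (by linarith) (by linarith)
  set B := yosida R l with hB
  set B' := yosida R k with hB'
  let G : ℝ → X := fun s => NormedSpace.exp ((t - s) • B) (NormedSpace.exp (s • B') x)
  have hG : ∀ s, HasDerivAt G
      (NormedSpace.exp ((t - s) • B) (NormedSpace.exp (s • B') (B' x - B x))) s := by
    intro s
    have h1 : HasDerivAt (fun s : ℝ => NormedSpace.exp ((t - s) • B))
        (-(NormedSpace.exp ((t - s) • B) * B)) s := by
      have := (hasDerivAt_exp_smul_const (𝕂 := ℝ) B (t - s)).scomp s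
        ((hasDerivAt_id s).const_sub t)
      rw [neg_one_smul] at this
      exact this
    have h2 := h1.clm_apply (hasDerivAt_exp_smul_apply B' x s)
    have h3 : B (NormedSpace.exp (s • B') x) = NormedSpace.exp (s • B') (B x) := by
      have : Commute B (NormedSpace.exp (s • B')) := (hcomm.smul_right s).exp_right
      exact congrArg (fun T : X →L[ℝ] X => T x) this.eq
    refine h2.congr_deriv ?_
    simp [h3, sub_eq_add_neg, add_comm]
  have hbd : ∀ s ∈ Ico (0 : ℝ) t,
      ‖NormedSpace.exp ((t - s) • B) (NormedSpace.exp (s • B') (B' x - B x))‖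
      ≤ (C * Real.exp (2 * b * t)) * (C * Real.exp (2 * b * t)) * ‖B' x - B x‖ := by
    intro s hs
    have hC := h.const_nonneg
    have e1 : ‖NormedSpace.exp ((t - s) • B)‖ ≤ C * Real.exp (2 * b * t) := by
      refine (h.norm_exp_yosida_le (l := l) (by linarith) (by linarith)
        (sub_nonneg.2 hs.2.le)).trans ?_
      gcongr
      linarith [hs.1]
    have e2 : ‖NormedSpace.exp (s • B')‖ ≤ C * Real.exp (2 * b * t) := by
      refine (h.norm_exp_yosida_le (l := k) (by linarith) (by linarith) hs.1).trans ?_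
      gcongr
      exact hs.2.le
    calc _ ≤ (C * Real.exp (2 * b * t)) * ‖NormedSpace.exp (s • B') (B' x - B x)‖ :=
          ContinuousLinearMap.le_of_opNorm_le _ e1 _
      _ ≤ (C * Real.exp (2 * b * t)) * ((C * Real.exp (2 * b * t)) * ‖B' x - B x‖) := by
          gcongr
          exact ContinuousLinearMap.le_of_opNorm_le _ e2 _
      _ = _ := by ring
  have := norm_image_sub_le_of_norm_deriv_le_segment' (f := G)
    (fun s _ => (hG s).hasDerivWithinAt) hbd t ⟨ht, le_rfl⟩
  simpa [G] using this

/-- The semigroup is constructed as the strong limit of the exponentials of the Yosida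
approximations. -/
theorem exists_limit (h : IsHilleYosidaResolvent A b C R) :
    ∃ S : ℝ≥0 → X →L[ℝ] X, ∀ (t : ℝ≥0) x, Tendsto (fun n : ℕ =>
      NormedSpace.exp ((t : ℝ) • yosida R (2 * b + 1 + n)) x) atTop (𝓝 (S t x)) := by
  have hb := h.nonneg
  let lam : ℕ → ℝ := fun n => 2 * b + 1 + n
  have hlam : ∀ n, 2 * b + 1 ≤ lam n := fun n => le_add_of_nonneg_right n.cast_nonneg
  have hlamT : Tendsto lam atTop atTop :=
    tendsto_atTop_add_const_left _ _ tendsto_natCast_atTop_atTop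
  have hbd : ∀ (t : ℝ≥0) n, ‖NormedSpace.exp ((t : ℝ) • yosida R (lam n))‖
      ≤ C * Real.exp (2 * b * t) := fun t n =>
    h.norm_exp_yosida_le (by linarith [hlam n]) (by linarith [hlam n]) t.2
  have hcauchy : ∀ (t : ℝ≥0) x,
      CauchySeq (fun n : ℕ => NormedSpace.exp ((t : ℝ) • yosida R (lam n)) x) := by
    intro t x
    rw [cauchySeq_iff_tendsto_dist_atTop_0]
    -- The Cauchy property is stated as strong convergence to `0` of operators indexed by pairs, so
    -- that it need only be checked on the dense domain.
    have key : Tendsto (fun p : ℕ × ℕ => (NormedSpace.exp ((t : ℝ) • yosida R (lam p.1)) -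
        NormedSpace.exp ((t : ℝ) • yosida R (lam p.2))) x) atTop (𝓝 ((0 : X →L[ℝ] X) x)) := by
      refine tendsto_apply_of_dense (M := C * Real.exp (2 * b * t) + C * Real.exp (2 * b * t))
        (Eventually.of_forall fun p => (norm_sub_le _ _).trans
          (add_le_add (hbd t _) (hbd t _))) h.dense ?_ x
      rintro x ⟨y, hxy⟩
      have h1 := (h.tendsto_yosida_apply hxy).comp hlamT
      have h2 : Tendsto (fun p : ℕ × ℕ => yosida R (lam p.1) x - yosida R (lam p.2) x) atTop
          (𝓝 0) := by
        have := (h1.comp tendsto_fst).sub (h1.comp (tendsto_snd (f := (atTop : Filter ℕ))))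
        rw [sub_self, prod_atTop_atTop_eq] at this
        exact this
      have h3 := (h2.norm.const_mul
        ((C * Real.exp (2 * b * t)) * (C * Real.exp (2 * b * t)))).mul_const (t : ℝ)
      rw [norm_zero, mul_zero, zero_mul] at h3
      refine squeeze_zero_norm (fun p => ?_) h3
      exact h.norm_exp_yosida_sub_le (hlam _) (hlam _) t.2 x
    simpa [dist_eq_norm] using key.norm
  choose g hg using fun (t : ℝ≥0) x => cauchySeq_tendsto_of_complete (hcauchy t x)
  refine ⟨fun t => continuousLinearMapOfTendsto
    (fun n : ℕ => NormedSpace.exp ((t : ℝ) • yosida R (lam n))) (f := g t)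
    (tendsto_pi_nhds.2 (hg t)), fun t x => ?_⟩
  exact hg t x

end IsHilleYosidaResolvent

/-- If `S x` has right derivative `y` at `0`, then the orbit of `x` has right derivative `S s y`
at `s`. -/
theorem hasDerivWithinAt_orbit {S : ℝ≥0 → X →L[ℝ] X}
    (hadd : ∀ s t, S (s + t) = (S s).comp (S t)) {x y : X}
    (h : Tendsto (fun k : ℝ≥0 => (k : ℝ)⁻¹ • (S k x - x)) (𝓝[>] 0) (𝓝 y)) {s : ℝ} (hs : 0 ≤ s) :
    HasDerivWithinAt (fun t : ℝ => S t.toNNReal x) (S s.toNNReal y) (Ici s) s := by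
  rw [hasDerivWithinAt_iff_tendsto_slope, Ici_sdiff_left]
  refine (((S s.toNNReal).continuous.tendsto y).comp (h.comp (tendsto_toNNReal_sub s))).congr' ?_
  filter_upwards [self_mem_nhdsWithin] with r hr
  have hr0 : (0 : ℝ) ≤ r - s := sub_nonneg.2 (le_of_lt hr)
  have a1 : r.toNNReal = s.toNNReal + (r - s).toNNReal := by
    rw [← Real.toNNReal_add hs hr0]; simp
  simp only [Function.comp_apply, slope_def_module]
  rw [a1, hadd]
  simp [Real.coe_toNNReal _ hr0]

variable [CompleteSpace X] {A : Submodule ℝ (X × X)} {b C : ℝ} {R : ℝ → X →L[ℝ] X}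

/-- The Hille–Yosida theorem. -/
theorem IsHilleYosidaResolvent.exists_semigroup (h : IsHilleYosidaResolvent A b C R) :
    ∃ S : ℝ≥0 → X →L[ℝ] X, IsSemigroupGeneratedBy S (A : Set (X × X)) := by
  obtain ⟨S, hS⟩ := h.exists_limit
  have hb := h.nonneg
  have hC := h.const_nonneg
  let lam : ℕ → ℝ := fun n => 2 * b + 1 + n
  have hlam : ∀ n, 2 * b + 1 ≤ lam n := fun n => le_add_of_nonneg_right n.cast_nonneg
  have hlamT : Tendsto lam atTop atTop :=
    tendsto_atTop_add_const_left _ _ tendsto_natCast_atTop_atTop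
  have hbd : ∀ (t : ℝ), 0 ≤ t → ∀ n, ‖NormedSpace.exp (t • yosida R (lam n))‖
      ≤ C * Real.exp (2 * b * t) := fun t ht n =>
    h.norm_exp_yosida_le (by linarith [hlam n]) (by linarith [hlam n]) ht
  have hSbd : ∀ (t : ℝ≥0) x, ‖S t x‖ ≤ C * Real.exp (2 * b * t) * ‖x‖ := fun t x =>
    le_of_tendsto (hS t x).norm (Eventually.of_forall fun n =>
      ContinuousLinearMap.le_of_opNorm_le _ (hbd t t.2 n) x)
  have hSbd' : ∀ t : ℝ≥0, ‖S t‖ ≤ C * Real.exp (2 * b * t) := fun t =>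
    ContinuousLinearMap.opNorm_le_bound _ (by positivity) (hSbd t)
  have hzero : S 0 = ContinuousLinearMap.id ℝ X := by
    ext x
    refine tendsto_nhds_unique (hS 0 x) ?_
    simp
  have hlim : ∀ (t : ℝ≥0) (u : ℕ → X) (x : X), Tendsto u atTop (𝓝 x) → Tendsto (fun n : ℕ =>
      NormedSpace.exp ((t : ℝ) • yosida R (lam n)) (u n)) atTop (𝓝 (S t x)) := by
    intro t u x hu
    have h1 : Tendsto (fun n : ℕ => NormedSpace.exp ((t : ℝ) • yosida R (lam n)) (u n - x)) atTop
        (𝓝 0) := by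
      have h2 := (hu.sub_const x).norm.const_mul (C * Real.exp (2 * b * t))
      rw [sub_self, norm_zero, mul_zero] at h2
      exact squeeze_zero_norm (fun n => ContinuousLinearMap.le_of_opNorm_le _ (hbd t t.2 n) _) h2
    have h3 := (hS t x).add h1
    rw [add_zero] at h3
    refine h3.congr fun n => ?_
    simp [lam]
  have hadd : ∀ s t, S (s + t) = (S s).comp (S t) := by
    intro s t
    ext x
    refine tendsto_nhds_unique (hS (s + t) x) ?_
    refine (hlim s _ _ (hS t x)).congr fun n => ?_
    let : NormedAlgebra ℚ (X →L[ℝ] X) := NormedAlgebra.restrictScalars ℚ ℝ _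
    rw [NNReal.coe_add, add_smul, NormedSpace.exp_add_of_commute
      (((Commute.refl _).smul_left _).smul_right _)]
    rfl
  have hint : ∀ x y, (x, y) ∈ A → ∀ t : ℝ, 0 ≤ t →
      Tendsto (fun n : ℕ => ∫ s in (0 : ℝ)..t, NormedSpace.exp (s • yosida R (lam n))
        (yosida R (lam n) x)) atTop (𝓝 (S t.toNNReal x - x)) := by
    intro x y hxy t ht
    have h1 := (hS t.toNNReal x).sub_const x
    rw [Real.coe_toNNReal t ht] at h1
    refine h1.congr fun n => ?_
    have hd := hasDerivAt_exp_smul_apply (yosida R (lam n))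
    rw [intervalIntegral.integral_eq_sub_of_hasDerivAt (fun s _ => hd x s)]
    · simp [lam]
    · refine Continuous.intervalIntegrable ?_ _ _
      exact continuous_iff_continuousAt.2 fun s => (hd _ s).continuousAt
  have hcont : ∀ x, Continuous fun t => S t x := by
    have hloc : ∀ x y, (x, y) ∈ A → Continuous fun t => S t x := by
      intro x y hxy
      have hy : Tendsto (fun n => yosida R (lam n) x) atTop (𝓝 y) :=
        (h.tendsto_yosida_apply hxy).comp hlamT
      obtain ⟨K, hK⟩ := hy.norm.bddAbove_range
      have hlip : ∀ T s t : ℝ≥0, s ≤ T → t ≤ T →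
          ‖S t x - S s x‖ ≤ C * Real.exp (2 * b * T) * K * ‖(t : ℝ) - s‖ := by
        intro T s t hs ht
        refine le_of_tendsto ((hS t x).sub (hS s x)).norm (Eventually.of_forall fun n => ?_)
        refine Convex.norm_image_sub_le_of_norm_hasDerivWithin_le (s := Icc (0 : ℝ) T)
          (fun r _ => (hasDerivAt_exp_smul_apply (yosida R (lam n)) x r).hasDerivWithinAt)
          (fun r hr => ?_) (convex_Icc _ _) ⟨s.2, hs⟩ ⟨t.2, ht⟩
        refine ContinuousLinearMap.le_of_opNorm_le_of_le _ ((hbd r hr.1 n).trans ?_)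
          (hK (mem_range_self n))
        gcongr
        exact hr.2
      rw [continuous_iff_continuousAt]
      intro t
      rw [ContinuousAt, tendsto_iff_norm_sub_tendsto_zero]
      have h0 : Tendsto (fun s : ℝ≥0 => C * Real.exp (2 * b * (t + 1 : ℝ≥0)) * K * ‖(s : ℝ) - t‖)
          (𝓝 t) (𝓝 0) := by
        have : Continuous (fun s : ℝ≥0 =>
          C * Real.exp (2 * b * (t + 1 : ℝ≥0)) * K * ‖(s : ℝ) - t‖) := by fun_prop
        simpa using this.tendsto t
      refine squeeze_zero' (Eventually.of_forall fun _ => norm_nonneg _) ?_ h0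
      filter_upwards [Iio_mem_nhds (lt_add_one t)] with s hs
      exact hlip (t + 1) t s (by simp) (le_of_lt hs)
    intro x
    rw [continuous_iff_continuousAt]
    intro t
    refine tendsto_apply_of_dense (M := C * Real.exp (2 * b * (t + 1))) ?_ h.dense ?_ x
    · filter_upwards [(Iio_mem_nhds (lt_add_one t))] with s hs
      refine (hSbd' s).trans ?_
      gcongr
      exact_mod_cast (le_of_lt hs)
    · rintro x ⟨y, hxy⟩
      exact (hloc x y hxy).tendsto t
  -- Dominated convergence in the integral formula for the approximations gives `S t x - x = ∫₀ᵗ S s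
  -- y ds`, which is then differentiated at `0`.
  have hgen : ∀ x y, (x, y) ∈ A →
      Tendsto (fun k : ℝ≥0 => (k : ℝ)⁻¹ • (S k x - x)) (𝓝[>] 0) (𝓝 y) := by
    intro x y hxy
    have hc : Continuous fun s : ℝ => S s.toNNReal y := (hcont y).comp continuous_real_toNNReal
    have h1 : ∀ t : ℝ, 0 ≤ t → S t.toNNReal x - x = ∫ s in (0 : ℝ)..t, S s.toNNReal y := by
      intro t ht
      refine tendsto_nhds_unique (hint x y hxy t ht) ?_
      have hy : Tendsto (fun n => yosida R (lam n) x) atTop (𝓝 y) :=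
        (h.tendsto_yosida_apply hxy).comp hlamT
      obtain ⟨K, hK⟩ := hy.norm.bddAbove_range
      refine intervalIntegral.tendsto_integral_filter_of_dominated_convergence
        (fun _ => C * Real.exp (2 * b * t) * K) ?_ ?_ ?_ ?_
      · refine Eventually.of_forall fun n => Continuous.aestronglyMeasurable ?_
        exact continuous_iff_continuousAt.2 fun s =>
          (hasDerivAt_exp_smul_apply _ _ s).continuousAt
      · refine Eventually.of_forall fun n => Eventually.of_forall fun s hs => ?_
        rw [uIoc_of_le ht] at hs
        refine ContinuousLinearMap.le_of_opNorm_le_of_le _ ((hbd s hs.1.le n).trans ?_)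
          (hK (mem_range_self n))
        gcongr
        exact hs.2
      · simp
      · refine Eventually.of_forall fun s hs => ?_
        rw [uIoc_of_le ht] at hs
        have := hlim s.toNNReal _ _ hy
        rwa [Real.coe_toNNReal s hs.1.le] at this
    have h2 : HasDerivAt (fun t : ℝ => ∫ s in (0 : ℝ)..t, S s.toNNReal y) y 0 := by
      have := intervalIntegral.integral_hasDerivAt_right (a := 0) (b := 0)
        (hc.intervalIntegrable _ _)
        hc.stronglyMeasurable.stronglyMeasurableAtFilter hc.continuousAt
      simpa [hzero] using this
    have h3 := (h2.hasDerivWithinAt (s := Ici 0))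
    rw [hasDerivWithinAt_iff_tendsto_slope, Ici_sdiff_left] at h3
    have h4 : Tendsto (fun k : ℝ≥0 => (k : ℝ)) (𝓝[>] 0) (𝓝[>] 0) := by
      refine tendsto_nhdsWithin_iff.2 ⟨?_, ?_⟩
      · exact (NNReal.continuous_coe.tendsto 0).mono_left nhdsWithin_le_nhds
      · filter_upwards [self_mem_nhdsWithin] with r hr
        exact_mod_cast hr
    refine (h3.comp h4).congr fun k => ?_
    have := h1 k k.2
    rw [Real.toNNReal_coe] at this
    simp [slope_def_module, this]
  refine ⟨S, hzero, hadd, hcont, fun x y => ⟨hgen x y, fun hxy => ?_⟩⟩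
  -- The generator of `S` is no larger than `A`: compare `x` with the element `x'` of the domain for
  -- which `l - A` takes the value `l x - y`. The difference `w` satisfies `S t w = exp (l t) w`,
  -- and `l` exceeds the growth rate `2 b` of `S`, so `w = 0`.
  set l : ℝ := 2 * b + 1
  have hl : b < l := by simp only [l]; linarith
  have hmem := h.mem l hl (l • x - y)
  set x' := R l (l • x - y)
  have hw := hxy.sub (hgen _ _ hmem)
  have hw' : Tendsto (fun k : ℝ≥0 => (k : ℝ)⁻¹ • (S k (x - x') - (x - x'))) (𝓝[>] 0)
      (𝓝 (l • (x - x'))) := by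
    have e : y - (l • x' - (l • x - y)) = l • (x - x') := by rw [smul_sub]; abel
    rw [e] at hw
    refine hw.congr fun k => ?_
    rw [← smul_sub, map_sub]
    congr 1
    abel
  have hzero' : x - x' = 0 := by
    set w := x - x'
    have hconst : ∀ t : ℝ, 0 ≤ t → Real.exp (-l * t) • S t.toNNReal w = w := by
      intro t ht
      have hd : ∀ s ∈ Ico 0 t, HasDerivWithinAt
          (fun s : ℝ => Real.exp (-l * s) • S s.toNNReal w) 0 (Ici s) s := by
        intro s hs
        have e1 : HasDerivWithinAt (fun s : ℝ => Real.exp (-l * s)) (Real.exp (-l * s) * (-l))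
            (Ici s) s := by
          have := ((hasDerivAt_id s).const_mul (-l)).exp
          simpa using this.hasDerivWithinAt
        refine (e1.smul (hasDerivWithinAt_orbit hadd hw' hs.1)).congr_deriv ?_
        rw [map_smul, smul_smul, ← add_smul]
        simp
      have hc : Continuous fun s : ℝ => Real.exp (-l * s) • S s.toNNReal w :=
        Continuous.smul (by fun_prop) ((hcont w).comp continuous_real_toNNReal)
      have := constant_of_has_deriv_right_zero hc.continuousOn hd t ⟨ht, le_rfl⟩
      simpa [hzero] using this
    have hle : ∀ t : ℝ, 0 ≤ t → ‖w‖ ≤ Real.exp (-t) * (C * ‖w‖) := by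
      intro t ht
      calc ‖w‖ = ‖Real.exp (-l * t) • S t.toNNReal w‖ := by rw [hconst t ht]
        _ ≤ Real.exp (-l * t) * (C * Real.exp (2 * b * t) * ‖w‖) := by
          rw [norm_smul, Real.norm_of_nonneg (Real.exp_pos _).le]
          have := hSbd t.toNNReal w
          rw [Real.coe_toNNReal t ht] at this
          gcongr
        _ = (Real.exp (-l * t) * Real.exp (2 * b * t)) * (C * ‖w‖) := by ring
        _ = Real.exp (-t) * (C * ‖w‖) := by
          rw [← Real.exp_add]
          congr 2
          simp only [l]
          ring
    have hlim0 : Tendsto (fun t : ℝ => Real.exp (-t) * (C * ‖w‖)) atTop (𝓝 0) := by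
      simpa using (Real.tendsto_exp_neg_atTop_nhds_zero).mul_const (C * ‖w‖)
    have := ge_of_tendsto hlim0 (by
      filter_upwards [eventually_ge_atTop 0] with t ht using hle t ht)
    exact norm_le_zero_iff.1 this
  have hx : x = x' := sub_eq_zero.1 hzero'
  rw [← hx] at hmem
  simpa using hmem

end HilleYosida

/-! ### From quasi-dissipativity and the range condition to a semigroup. -/

section LumerPhillips

variable {X : Type*} [NormedAddCommGroup X] [InnerProductSpace ℝ X]

/-- `A` is (the graph of) a linear operator that is quasi-dissipative with respect to the inner
product `E`, and `l - A` is onto for all large `l`. -/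
structure IsQuasiDissipative (A : Submodule ℝ (X × X)) (E : X →L[ℝ] X →L[ℝ] ℝ) (b : ℝ) : Prop where
  nonneg : 0 ≤ b
  coercive : IsCoercive E
  symm : ∀ x y, E x y = E y x
  le : ∀ x y, (x, y) ∈ A → E x y ≤ b * E x x
  surj : ∀ l > b, ∀ z, ∃ x y, (x, y) ∈ A ∧ l • x - y = z
  single_valued : ∀ y, (0, y) ∈ A → y = 0

namespace IsQuasiDissipative

variable {A : Submodule ℝ (X × X)} {E : X →L[ℝ] X →L[ℝ] ℝ} {b : ℝ}

theorem self_nonneg (h : IsQuasiDissipative A E b) (x : X) : 0 ≤ E x x := by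
  obtain ⟨c, hc, hE⟩ := h.coercive
  exact le_trans (by positivity) (hE x)

theorem eq_zero (h : IsQuasiDissipative A E b) {x : X} (hx : E x x ≤ 0) : x = 0 := by
  obtain ⟨c, hc, hE⟩ := h.coercive
  by_contra hne
  have : 0 < ‖x‖ := norm_pos_iff.2 hne
  have : 0 < c * ‖x‖ * ‖x‖ := by positivity
  linarith [hE x]

/-- With `z = l x - y`, dissipativity gives `(l - b) E x x ≤ E x z`; now expand the nonnegative
quantity `E` at `z - (l - b) x`. -/
theorem resolvent_le (h : IsQuasiDissipative A E b) {l : ℝ} (hl : b < l) {x y : X}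
    (hxy : (x, y) ∈ A) : (l - b) ^ 2 * E x x ≤ E (l • x - y) (l • x - y) := by
  set z := l • x - y
  have h1 : (l - b) * E x x ≤ E x z := by
    have : E x z = l * E x x - E x y := by simp [z]
    linarith [h.le x y hxy]
  have h2 := h.self_nonneg (z - (l - b) • x)
  have h3 : E (z - (l - b) • x) (z - (l - b) • x)
      = E z z - 2 * (l - b) * E x z + (l - b) ^ 2 * E x x := by
    simp only [map_sub, map_smul, _root_.sub_apply, _root_.smul_apply,
      smul_eq_mul, h.symm z x]
    ring
  rw [h3] at h2
  nlinarith

theorem exists_resolvent (h : IsQuasiDissipative A E b) {l : ℝ} (hl : b < l) :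
    ∃ R : X →L[ℝ] X, (∀ z, (R z, l • R z - z) ∈ A) ∧
      ∀ x y, (x, y) ∈ A → R (l • x - y) = x := by
  choose f g hfg hz using h.surj l hl
  have huniq : ∀ x y, (x, y) ∈ A → f (l • x - y) = x := by
    intro x y hxy
    have h1 := A.sub_mem (hfg (l • x - y)) hxy
    have h2 := h.resolvent_le hl h1
    have h3 : l • (f (l • x - y) - x) - (g (l • x - y) - y) = 0 := by
      have := hz (l • x - y)
      rw [smul_sub, sub_sub_sub_comm, this, sub_self]
    simp only at h2
    rw [h3] at h2
    simp only [map_zero] at h2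
    refine sub_eq_zero.1 (h.eq_zero ?_)
    have : 0 < (l - b) ^ 2 := by have := sub_pos.2 hl; positivity
    exact nonpos_of_mul_nonpos_right h2 this
  have hgz : ∀ z, g z = l • f z - z := fun z => by
    rw [eq_sub_iff_add_eq, ← eq_sub_iff_add_eq', hz]
  obtain ⟨c, hc, hE⟩ := h.coercive
  let F : X →ₗ[ℝ] X :=
    { toFun := f
      map_add' := fun z w => by
        have := huniq _ _ (A.add_mem (hfg z) (hfg w))
        have e : l • (f z + f w) - (g z + g w) = z + w := by
          rw [smul_add, add_sub_add_comm, hz, hz]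
        simp only at this
        rwa [e] at this
      map_smul' := fun r z => by
        have := huniq _ _ (A.smul_mem r (hfg z))
        have e : l • (r • f z) - r • g z = r • z := by
          rw [smul_comm, ← smul_sub, hz]
        simp only at this
        rwa [e] at this }
  have hpos : 0 < (l - b) ^ 2 * c := by have := sub_pos.2 hl; positivity
  have hbound : ∀ z, ‖F z‖ ≤ Real.sqrt (‖E‖ / ((l - b) ^ 2 * c)) * ‖z‖ := by
    intro z
    have h1 := h.resolvent_le hl (hfg z)
    rw [hz] at h1
    have h2 : E z z ≤ ‖E‖ * ‖z‖ * ‖z‖ := (le_abs_self _).trans (E.le_opNorm₂ z z)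
    have h3 := hE (f z)
    refine le_of_sq_le_sq ?_ (by positivity)
    rw [mul_pow, Real.sq_sqrt (by positivity), div_mul_eq_mul_div, le_div_iff₀ hpos]
    change ‖f z‖ ^ 2 * _ ≤ _
    nlinarith [sq_nonneg (l - b)]
  refine ⟨F.mkContinuous _ hbound, fun z => ?_, huniq⟩
  have := hfg z
  rwa [hgz] at this

/-- A vector orthogonal to the domain is represented by some `z` with `E z x = 0` for all `x` in the
domain. Solving `(b + 1) x - y = z` gives `(b + 1) E x x = E x y ≤ b E x x`, so `x`, then `y` and
`z`, vanish. -/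
theorem dense_domain [CompleteSpace X] (h : IsQuasiDissipative A E b) :
    Dense {x | ∃ y, (x, y) ∈ A} := by
  have key : (A.map (LinearMap.fst ℝ X X)).topologicalClosure = ⊤ := by
    rw [Submodule.topologicalClosure_eq_top_iff, Submodule.eq_bot_iff]
    intro w hw
    obtain ⟨z, rfl⟩ := h.coercive.continuousLinearEquivOfBilin.surjective w
    obtain ⟨x, y, hxy, hz⟩ := h.surj (b + 1) (lt_add_one b) z
    have h1 : E z x = 0 := by
      rw [← h.coercive.continuousLinearEquivOfBilin_apply, real_inner_comm]
      exact hw x ⟨(x, y), hxy, rfl⟩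
    have h2 : E x x ≤ 0 := by
      have : E x z = (b + 1) * E x x - E x y := by rw [← hz]; simp
      rw [h.symm, this] at h1
      linarith [h.le x y hxy]
    obtain rfl := h.eq_zero h2
    obtain rfl := h.single_valued y hxy
    simp [← hz]
  have := (Submodule.dense_iff_topologicalClosure_eq_top).2 key
  convert this using 1
  ext x
  simp

/-- In the norm of `E` the resolvent has norm at most `1 / (l - b)`, which iterates without loss.
Changing back to the original norm costs the factor `√(‖E‖ / c)` only once, whatever the power. -/
theorem exists_isHilleYosidaResolvent [CompleteSpace X] (h : IsQuasiDissipative A E b) :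
    ∃ C R, IsHilleYosidaResolvent A b C R := by
  have hex : ∀ l : ℝ, ∃ R : X →L[ℝ] X, b < l → (∀ z, (R z, l • R z - z) ∈ A) ∧
      ∀ x y, (x, y) ∈ A → R (l • x - y) = x := fun l => by
    by_cases hl : b < l
    · obtain ⟨R, hR⟩ := h.exists_resolvent hl
      exact ⟨R, fun _ => hR⟩
    · exact ⟨0, fun h => absurd h hl⟩
  choose R hR using hex
  obtain ⟨c, hc, hE⟩ := h.coercive
  refine ⟨Real.sqrt (‖E‖ / c), R, h.nonneg, fun l hl => (hR l hl).1, fun l hl => (hR l hl).2,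
    fun l hl n => ?_, h.dense_domain⟩
  have hpos : 0 < l - b := sub_pos.2 hl
  have hstep : ∀ z, (l - b) ^ 2 * E (R l z) (R l z) ≤ E z z := fun z => by
    simpa using h.resolvent_le hl ((hR l hl).1 z)
  have hpow : ∀ z, ((l - b) ^ n) ^ 2 * E ((R l ^ n) z) ((R l ^ n) z) ≤ E z z := by
    intro z
    induction n with
    | zero => simp
    | succ n ih =>
      refine le_trans ?_ ih
      have e : (R l ^ (n + 1)) z = R l ((R l ^ n) z) := by rw [pow_succ']; rfl
      rw [e]
      calc _ = ((l - b) ^ n) ^ 2 * ((l - b) ^ 2 * E (R l ((R l ^ n) z)) (R l ((R l ^ n) z))) := by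
            ring
        _ ≤ _ := by gcongr; exact hstep _
  refine ContinuousLinearMap.opNorm_le_bound _ (by positivity) fun z => ?_
  have h2 : E z z ≤ ‖E‖ * ‖z‖ * ‖z‖ := (le_abs_self _).trans (E.le_opNorm₂ z z)
  have h3 := hE ((R l ^ n) z)
  rw [div_mul_eq_mul_div, le_div_iff₀ (by positivity)]
  refine le_of_sq_le_sq ?_ (by positivity)
  rw [mul_pow, mul_pow, Real.sq_sqrt (by positivity), div_mul_eq_mul_div, le_div_iff₀ hc]
  have h4 := hpow z
  have h5 : 0 ≤ ((l - b) ^ n) ^ 2 := by positivity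
  nlinarith

/-- A form of the Lumer–Phillips theorem: quasi-dissipative operators with the range condition
generate strongly continuous semigroups. -/
theorem exists_semigroup [CompleteSpace X] (h : IsQuasiDissipative A E b) :
    ∃ S : ℝ≥0 → X →L[ℝ] X, IsSemigroupGeneratedBy S (A : Set (X × X)) := by
  obtain ⟨C, R, hR⟩ := h.exists_isHilleYosidaResolvent
  exact hR.exists_semigroup

end IsQuasiDissipative

end LumerPhillips

/-! ### Abstract semilinear Cauchy problems with locally Lipschitz nonlinearity. -/

section Semilinear

variable {X : Type*} [NormedAddCommGroup X] [NormedSpace ℝ X]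

/-- `U` is a mild solution of `U' = A U + F(U)`, `U(0) = U₀`, on `I`, where `A` generates `S`. -/
def IsMild (S : ℝ≥0 → X →L[ℝ] X) (F : X → X) (U₀ : X) (I : Set ℝ) (U : ℝ → X) : Prop :=
  ContinuousOn U I ∧ ∀ t ∈ I,
    U t = S t.toNNReal U₀ + ∫ s in (0 : ℝ)..t, S (t - s).toNNReal (F (U s))

/-- A strongly continuous semigroup together with a nonlinearity that is Lipschitz on balls. -/
structure IsSemilinear (S : ℝ≥0 → X →L[ℝ] X) (F : X → X) : Prop where
  zero : S 0 = ContinuousLinearMap.id ℝ X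
  add : ∀ s t, S (s + t) = (S s).comp (S t)
  cont : Continuous fun q : ℝ≥0 × X => S q.1 q.2
  bounded : ∀ T, ∃ M, ∀ t ≤ T, ‖S t‖ ≤ M
  lip : ∀ R, ∃ L, ∀ x y, ‖x‖ ≤ R → ‖y‖ ≤ R → ‖F x - F y‖ ≤ L * ‖x - y‖

variable {S : ℝ≥0 → X →L[ℝ] X} {F : X → X} {U₀ : X}

/-- The set `J` contains `[0, t]` along with `t`, so the Duhamel integral up to `t ∈ J` sees only
values on `J`. -/
theorem IsMild.mono_congr {I J : Set ℝ} {U V : ℝ → X} (h : IsMild S F U₀ I U) (hJI : J ⊆ I)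
    (hJ : ∀ t ∈ J, 0 ≤ t ∧ Icc 0 t ⊆ J) (hVU : EqOn V U J) : IsMild S F U₀ J V := by
  refine ⟨(h.1.mono hJI).congr hVU, fun t ht => ?_⟩
  rw [hVU ht, h.2 t (hJI ht)]
  congr 1
  refine intervalIntegral.integral_congr fun s hs => ?_
  rw [uIcc_of_le (hJ t ht).1] at hs
  simp only [hVU ((hJ t ht).2 hs)]

theorem IsMild.mono_Icc {a b : ℝ} {U : ℝ → X} (h : IsMild S F U₀ (Icc 0 b) U) (hab : a ≤ b) :
    IsMild S F U₀ (Icc 0 a) U :=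
  h.mono_congr (Icc_subset_Icc_right hab) (fun _ ht => ⟨ht.1, Icc_subset_Icc_right ht.2⟩)
    fun _ _ => rfl

/-- Extending by constants beyond the endpoints makes the integrands continuous on the whole line,
which settles all integrability questions. -/
theorem IsMild.exists_continuous {b : ℝ} (hb : 0 ≤ b) {U : ℝ → X} (h : IsMild S F U₀ (Icc 0 b) U) :
    ∃ V, Continuous V ∧ EqOn V U (Icc 0 b) ∧ IsMild S F U₀ (Icc 0 b) V := by
  have heq : EqOn (IccExtend hb ((Icc 0 b).domRestrict U)) U (Icc 0 b) := fun t ht => by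
    rw [IccExtend_of_mem _ _ ht]; rfl
  exact ⟨_, (continuousOn_iff_continuous_domRestrict.1 h.1).Icc_extend', heq,
    h.mono_congr Subset.rfl (fun _ ht => ⟨ht.1, Icc_subset_Icc_right ht.2⟩) heq⟩

namespace IsSemilinear

variable (h : IsSemilinear S F)
include h

theorem continuous_right : Continuous F := by
  rw [continuous_iff_continuousAt]
  intro x
  obtain ⟨L, hL⟩ := h.lip (‖x‖ + 1)
  rw [ContinuousAt, tendsto_iff_norm_sub_tendsto_zero]
  have h0 : Tendsto (fun y => L * ‖y - x‖) (𝓝 x) (𝓝 0) := by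
    have : Continuous fun y => L * ‖y - x‖ := by fun_prop
    simpa using this.tendsto x
  refine squeeze_zero' (Eventually.of_forall fun _ => norm_nonneg _) ?_ h0
  have : ∀ᶠ y in 𝓝 x, ‖y‖ < ‖x‖ + 1 :=
    continuous_norm.continuousAt.eventually_lt continuousAt_const (lt_add_one _)
  filter_upwards [this] with y hy using hL y x hy.le (by linarith)

theorem continuous_integrand {U : ℝ → X} (hU : Continuous U) :
    Continuous fun q : ℝ × ℝ => S (q.1 - q.2).toNNReal (F (U q.2)) :=
  h.cont.comp ((continuous_real_toNNReal.comp (continuous_fst.sub continuous_snd)).prodMk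
    (h.continuous_right.comp (hU.comp continuous_snd)))

theorem continuous_integrand_right {U : ℝ → X} (hU : Continuous U) (t : ℝ) :
    Continuous fun s : ℝ => S (t - s).toNNReal (F (U s)) :=
  (h.continuous_integrand hU).comp (continuous_const.prodMk continuous_id)

/-- Uniqueness of mild solutions, by Gronwall's inequality. -/
theorem eqOn {b : ℝ} {U V : ℝ → X} (hU : IsMild S F U₀ (Icc 0 b) U)
    (hV : IsMild S F U₀ (Icc 0 b) V) : EqOn U V (Icc 0 b) := by
  rcases lt_or_ge b 0 with hb | hb
  · simp [Icc_eq_empty_of_lt hb]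
  obtain ⟨U', hUc, hUe, hU'⟩ := hU.exists_continuous hb
  obtain ⟨V', hVc, hVe, hV'⟩ := hV.exists_continuous hb
  suffices EqOn U' V' (Icc 0 b) from (hUe.symm.trans this).trans hVe
  obtain ⟨R₁, hR₁⟩ := isCompact_Icc.exists_bound_of_continuousOn (s := Icc 0 b) hUc.continuousOn
  obtain ⟨R₂, hR₂⟩ := isCompact_Icc.exists_bound_of_continuousOn (s := Icc 0 b) hVc.continuousOn
  obtain ⟨L, hL⟩ := h.lip (max R₁ R₂)
  obtain ⟨M, hM⟩ := h.bounded b.toNNReal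
  have hM0 : 0 ≤ M := (norm_nonneg _).trans (hM 0 bot_le)
  let d : ℝ → ℝ := fun t => ‖U' t - V' t‖
  have hd : Continuous d := by fun_prop
  -- The difference `d` is merely continuous, so the differential form of Gronwall is applied to its
  -- integral `g`, for which `g' = d ≤ M L g`.
  let g : ℝ → ℝ := fun t => ∫ s in (0 : ℝ)..t, d s
  have hg : ∀ t, HasDerivAt g (d t) t := fun t =>
    intervalIntegral.integral_hasDerivAt_right (hd.intervalIntegrable _ _)
      hd.stronglyMeasurable.stronglyMeasurableAtFilter hd.continuousAt
  have hdg : ∀ t ∈ Icc 0 b, d t ≤ M * L * g t := by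
    intro t ht
    have e : U' t - V' t = ∫ s in (0 : ℝ)..t,
        (S (t - s).toNNReal (F (U' s)) - S (t - s).toNNReal (F (V' s))) := by
      rw [hU'.2 t ht, hV'.2 t ht, intervalIntegral.integral_sub
        ((h.continuous_integrand_right hUc t).intervalIntegrable _ _)
        ((h.continuous_integrand_right hVc t).intervalIntegrable _ _)]
      abel
    calc d t = ‖∫ s in (0 : ℝ)..t,
        (S (t - s).toNNReal (F (U' s)) - S (t - s).toNNReal (F (V' s)))‖ := by rw [← e]
      _ ≤ ∫ s in (0 : ℝ)..t, M * L * d s := by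
        refine intervalIntegral.norm_integral_le_of_norm_le ht.1 ?_
          ((hd.const_mul _).intervalIntegrable _ _)
        refine Eventually.of_forall fun s hs => ?_
        have hs' : s ∈ Icc 0 b := ⟨hs.1.le, hs.2.trans ht.2⟩
        rw [← map_sub, mul_assoc]
        refine ContinuousLinearMap.le_of_opNorm_le_of_le _ (hM _ ?_) (hL _ _ ?_ ?_)
        · exact Real.toNNReal_le_toNNReal (by linarith [hs.1, ht.2])
        · exact (hR₁ s hs').trans (le_max_left _ _)
        · exact (hR₂ s hs').trans (le_max_right _ _)
      _ = M * L * g t := intervalIntegral.integral_const_mul _ _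
  have hg0 : ∀ t, 0 ≤ t → 0 ≤ g t := fun t ht =>
    intervalIntegral.integral_nonneg ht fun _ _ => norm_nonneg _
  intro t ht
  have h1 := norm_le_gronwallBound_of_norm_deriv_right_le (f := g) (f' := d) (δ := 0) (K := M * L)
    (ε := 0) (a := 0) (b := b) (fun t _ => (hg t).continuousAt.continuousWithinAt)
    (fun t _ => (hg t).hasDerivWithinAt) (by simp [g]) (fun t ht => by
      rw [Real.norm_of_nonneg (norm_nonneg _), Real.norm_of_nonneg (hg0 t ht.1), add_zero]
      exact hdg t ⟨ht.1, ht.2.le⟩) t ht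
  rw [gronwallBound_ε0_δ0] at h1
  have h2 := hdg t ht
  rw [norm_le_zero_iff.1 h1, mul_zero] at h2
  exact sub_eq_zero.1 (norm_le_zero_iff.1 h2)

/-- Concatenation of mild solutions. -/
theorem concat [CompleteSpace X] {a c : ℝ} (ha : 0 ≤ a) (hc : 0 ≤ c) {U V : ℝ → X}
    (hU : IsMild S F U₀ (Icc 0 a) U)
    (hV : IsMild S F (U a) (Icc 0 c) V) : ∃ W, IsMild S F U₀ (Icc 0 (a + c)) W := by
  obtain ⟨U', hUc, hUe, hU'⟩ := hU.exists_continuous ha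
  obtain ⟨V', hVc, hVe, hV'⟩ := hV.exists_continuous hc
  rw [← hUe ⟨ha, le_rfl⟩] at hV'
  have hV0 : V' 0 = U' a := by
    have := hV'.2 0 ⟨le_rfl, hc⟩
    simpa [h.zero] using this
  let W : ℝ → X := fun t => if t ≤ a then U' t else V' (t - a)
  have hWU : ∀ t, t ≤ a → W t = U' t := fun t ht => if_pos ht
  have hWV : ∀ t, a ≤ t → W t = V' (t - a) := fun t ht => by
    rcases ht.eq_or_lt with rfl | ht
    · simp [W, hV0]
    · exact if_neg (not_le.2 ht)
  have hW : Continuous W := Continuous.if_le hUc (hVc.comp (continuous_id.sub continuous_const))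
    continuous_id continuous_const (fun t ht => by simp [show t = a from ht, hV0])
  refine ⟨W, hW.continuousOn, fun t ht => ?_⟩
  have hi : ∀ p q, IntervalIntegrable (fun s : ℝ => S (t - s).toNNReal (F (W s))) volume p q :=
    fun p q => (h.continuous_integrand_right hW t).intervalIntegrable _ _
  rcases le_total t a with hta | hta
  · rw [hWU t hta, hU'.2 t ⟨ht.1, hta⟩]
    congr 1
    refine intervalIntegral.integral_congr fun s hs => ?_
    rw [uIcc_of_le ht.1] at hs
    simp only [hWU s (hs.2.trans hta)]
  · have hta' : 0 ≤ t - a := sub_nonneg.2 hta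
    have e1 : ∫ s in a..t, S (t - s).toNNReal (F (W s))
        = ∫ s in (0 : ℝ)..(t - a), S (t - a - s).toNNReal (F (V' s)) := by
      have := intervalIntegral.integral_comp_sub_right (a := a) (b := t)
        (fun s => S (t - a - s).toNNReal (F (V' s))) a
      rw [sub_self] at this
      rw [← this]
      refine intervalIntegral.integral_congr fun s hs => ?_
      rw [uIcc_of_le hta] at hs
      simp only [hWV s hs.1]
      congr 3
      ring
    -- The semigroup law pulls `S (t - a)` out of everything that happened before time `a`; what it
    -- acts on is the Duhamel formula for `U' a`.
    have hsplit : ∀ s, 0 ≤ s → s ≤ a → ∀ x, S (t - a).toNNReal (S (a - s).toNNReal x)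
        = S (t - s).toNNReal x := by
      intro s _ hsa x
      rw [← ContinuousLinearMap.comp_apply, ← h.add,
        ← Real.toNNReal_add hta' (sub_nonneg.2 hsa)]
      congr 3
      ring
    have e2 : ∫ s in (0 : ℝ)..a, S (t - s).toNNReal (F (W s))
        = S (t - a).toNNReal (∫ s in (0 : ℝ)..a, S (a - s).toNNReal (F (U' s))) := by
      rw [← ContinuousLinearMap.intervalIntegral_comp_comm _
        ((h.continuous_integrand_right hUc a).intervalIntegrable _ _)]
      refine intervalIntegral.integral_congr fun s hs => ?_
      rw [uIcc_of_le ha] at hs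
      simp only [hWU s hs.2]
      exact (hsplit s hs.1 hs.2 _).symm
    have e3 : S t.toNNReal U₀ = S (t - a).toNNReal (S a.toNNReal U₀) := by
      have := hsplit 0 le_rfl ha U₀
      simpa using this.symm
    rw [← intervalIntegral.integral_add_adjacent_intervals (hi 0 a) (hi a t), e1, e2, e3,
      ← add_assoc, ← map_add, ← hU'.2 a ⟨ha, le_rfl⟩, hWV t hta]
    exact hV'.2 (t - a) ⟨hta', by linarith [ht.2]⟩

/-- Local existence, on a time interval which depends only on the size of the initial datum. -/
theorem exists_local [CompleteSpace X] (R : ℝ) :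
    ∃ δ > 0, ∀ U₀, ‖U₀‖ ≤ R → ∃ U, IsMild S F U₀ (Icc 0 δ) U := by
  rcases lt_or_ge R 0 with hR | hR
  · exact ⟨1, one_pos, fun U₀ h0 => absurd (norm_nonneg U₀) (by linarith)⟩
  obtain ⟨M, hM⟩ := h.bounded 1
  have hM0 : 0 ≤ M := (norm_nonneg _).trans (hM 0 bot_le)
  -- `M * R` bounds the linear evolution up to time `1`; the extra `1` leaves room for the integral.
  set r : ℝ := M * R + 1
  have hr : 0 ≤ r := by positivity
  obtain ⟨L', hL'⟩ := h.lip r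
  set L := |L'|
  have hL : ∀ x y, ‖x‖ ≤ r → ‖y‖ ≤ r → ‖F x - F y‖ ≤ L * ‖x - y‖ := fun x y hx hy =>
    (hL' x y hx hy).trans (by gcongr; exact le_abs_self _)
  have hL0 : 0 ≤ L := abs_nonneg _
  set K : ℝ := ‖F 0‖ + L * r
  have hK0 : 0 ≤ K := by positivity
  have hK : ∀ x, ‖x‖ ≤ r → ‖F x‖ ≤ K := fun x hx => by
    have h1 := hL x 0 hx (by simpa using hr)
    rw [sub_zero] at h1
    calc ‖F x‖ = ‖F 0 + (F x - F 0)‖ := by congr 1; abel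
      _ ≤ ‖F 0‖ + ‖F x - F 0‖ := norm_add_le _ _
      _ ≤ ‖F 0‖ + L * ‖x‖ := by gcongr
      _ ≤ K := by simp only [K]; gcongr
  -- The three summands of the denominator yield `δ ≤ 1`, `δ M K ≤ 1` (the ball is mapped into
  -- itself) and `δ M L ≤ 1 / 2` (contraction).
  set δ : ℝ := 1 / (1 + M * K + 2 * (M * L))
  have hden : 0 < 1 + M * K + 2 * (M * L) := by positivity
  have hδ : 0 < δ := by positivity
  have hδ' : δ * (1 + M * K + 2 * (M * L)) = 1 := one_div_mul_cancel hden.ne'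
  have hMK : 0 ≤ δ * (M * K) := by positivity
  have hML : 0 ≤ δ * (M * L) := by positivity
  have hδ1 : δ ≤ 1 := by nlinarith
  have hδK : δ * (M * K) ≤ 1 := by nlinarith
  have hδL : δ * (M * L) ≤ 1 / 2 := by nlinarith
  refine ⟨δ, hδ, fun U₀ hU₀ => ?_⟩
  have hMt : ∀ t : ℝ, t ≤ δ → ‖S t.toNNReal‖ ≤ M := fun t ht =>
    hM _ (by rw [Real.toNNReal_le_one]; linarith)
  let ext : C(Icc (0 : ℝ) δ, X) → ℝ → X := fun u => IccExtend hδ.le u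
  have hext : ∀ u, Continuous (ext u) := fun u => u.continuous.Icc_extend'
  let Φ₀ : C(Icc (0 : ℝ) δ, X) → ℝ → X := fun u t =>
    S t.toNNReal U₀ + ∫ s in (0 : ℝ)..t, S (t - s).toNNReal (F (ext u s))
  have hΦ₀ : ∀ u, Continuous (Φ₀ u) := fun u =>
    (h.cont.comp (continuous_real_toNNReal.prodMk continuous_const)).add
      (intervalIntegral.continuous_parametric_intervalIntegral_of_continuous
        (h.continuous_integrand (hext u)) continuous_id)
  let Φ : C(Icc (0 : ℝ) δ, X) → C(Icc (0 : ℝ) δ, X) := fun u =>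
    ⟨fun t => Φ₀ u t, (hΦ₀ u).comp continuous_subtype_val⟩
  let B : Set C(Icc (0 : ℝ) δ, X) := Metric.closedBall 0 r
  have hB : ∀ u ∈ B, ∀ s, ‖ext u s‖ ≤ r := fun u hu s => by
    have hu' : ‖u‖ ≤ r := by simpa [B] using hu
    exact (u.norm_coe_le_norm _).trans hu'
  have hmaps : MapsTo Φ B B := by
    intro u hu
    have : ‖Φ u‖ ≤ r := by
      rw [ContinuousMap.norm_le _ hr]
      rintro ⟨t, ht⟩
      have h1 : ‖∫ s in (0 : ℝ)..t, S (t - s).toNNReal (F (ext u s))‖ ≤ M * K * |t - 0| := by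
        refine intervalIntegral.norm_integral_le_of_norm_le_const fun s hs => ?_
        rw [uIoc_of_le ht.1] at hs
        exact ContinuousLinearMap.le_of_opNorm_le_of_le _ (hMt _ (by linarith [ht.2, hs.1]))
          (hK _ (hB u hu s))
      rw [sub_zero, abs_of_nonneg ht.1] at h1
      have h2 : M * K * t ≤ 1 := by nlinarith [mul_nonneg hM0 hK0, ht.2]
      have h3 : ‖S t.toNNReal U₀‖ ≤ M * R :=
        ContinuousLinearMap.le_of_opNorm_le_of_le _ (hMt t ht.2) hU₀
      exact (norm_add_le _ _).trans (by simp only [r]; linarith)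
    simpa [B] using this
  have hcontr : ContractingWith (1 / 2) (hmaps.restrict Φ B B) := by
    refine ⟨by rw [← NNReal.coe_lt_coe]; norm_num, LipschitzWith.of_dist_le_mul ?_⟩
    rintro ⟨u, hu⟩ ⟨v, hv⟩
    change dist (Φ u) (Φ v) ≤ _ * dist u v
    rw [dist_eq_norm, dist_eq_norm, ContinuousMap.norm_le _ (by positivity)]
    rintro ⟨t, ht⟩
    have e : (Φ u - Φ v) ⟨t, ht⟩ = ∫ s in (0 : ℝ)..t,
        (S (t - s).toNNReal (F (ext u s)) - S (t - s).toNNReal (F (ext v s))) := by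
      rw [intervalIntegral.integral_sub
        ((h.continuous_integrand_right (hext u) t).intervalIntegrable _ _)
        ((h.continuous_integrand_right (hext v) t).intervalIntegrable _ _)]
      exact add_sub_add_left_eq_sub _ _ _
    have h1 : ‖(Φ u - Φ v) ⟨t, ht⟩‖ ≤ M * (L * ‖u - v‖) * |t - 0| := by
      rw [e]
      refine intervalIntegral.norm_integral_le_of_norm_le_const fun s hs => ?_
      rw [uIoc_of_le ht.1] at hs
      rw [← map_sub]
      refine ContinuousLinearMap.le_of_opNorm_le_of_le _ (hMt _ (by linarith [ht.2, hs.1]))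
        ((hL _ _ (hB u hu s) (hB v hv s)).trans ?_)
      gcongr
      exact (u - v).norm_coe_le_norm _
    rw [sub_zero, abs_of_nonneg ht.1] at h1
    refine h1.trans ?_
    have h2 : M * L * t ≤ 1 / 2 := by nlinarith [mul_nonneg hM0 hL0, ht.2]
    have h3 := mul_le_mul_of_nonneg_right h2 (norm_nonneg (u - v))
    push_cast
    linarith
  obtain ⟨u, -, hu, -⟩ := ContractingWith.exists_fixedPoint'
    Metric.isClosed_closedBall.isComplete hmaps hcontr
    (x := 0) (by simpa [B] using hr) (edist_ne_top _ _)
  refine ⟨ext u, (hext u).continuousOn, fun t ht => ?_⟩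
  have h1 : ext u t = u ⟨t, ht⟩ := IccExtend_of_mem _ _ ht
  rw [h1]
  nth_rw 1 [← hu]
  rfl

/-- Existence of a maximal mild solution, with the blow-up alternative. -/
theorem exists_maximal [CompleteSpace X] : ∃ T : X → ℝ≥0∞, (∀ U₀, 0 < T U₀) ∧
    ∀ U₀ : X, ∃ U : ℝ → X, IsMild S F U₀ {t : ℝ | 0 ≤ t ∧ ENNReal.ofReal t < T U₀} U ∧
      (∀ τ : ℝ, 0 < τ → ENNReal.ofReal τ < T U₀ → ∀ V : ℝ → X,
        IsMild S F U₀ (Icc 0 τ) V → EqOn V U (Icc 0 τ)) ∧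
      (T U₀ ≠ ⊤ → Tendsto (fun t => ‖U t‖) (𝓝[<] (T U₀).toReal) atTop) := by
  let E : X → Set ℝ := fun U₀ => {τ | 0 < τ ∧ ∃ U, IsMild S F U₀ (Icc 0 τ) U}
  let T : X → ℝ≥0∞ := fun U₀ => ⨆ τ ∈ E U₀, ENNReal.ofReal τ
  have hE : ∀ {U₀ τ}, τ ∈ E U₀ → ENNReal.ofReal τ ≤ T U₀ := fun {U₀ τ} hτ =>
    le_iSup₂ (f := fun τ (_ : τ ∈ E U₀) => ENNReal.ofReal τ) τ hτ
  have hT : ∀ U₀, 0 < T U₀ := by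
    intro U₀
    obtain ⟨δ, hδ, hex⟩ := h.exists_local ‖U₀‖
    exact (ENNReal.ofReal_pos.2 hδ).trans_le (hE ⟨hδ, hex U₀ le_rfl⟩)
  refine ⟨T, hT, fun U₀ => ?_⟩
  have hsol : ∀ t : ℝ, ∃ τ U, 0 ≤ t ∧ ENNReal.ofReal t < T U₀ →
      t < τ ∧ τ ∈ E U₀ ∧ IsMild S F U₀ (Icc 0 τ) U := by
    intro t
    by_cases ht : 0 ≤ t ∧ ENNReal.ofReal t < T U₀
    · obtain ⟨τ, hτ, htτ⟩ :=
        (by simpa only [T, lt_iSup_iff, exists_prop] using ht.2 :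
        ∃ τ ∈ E U₀, ENNReal.ofReal t < ENNReal.ofReal τ)
      obtain ⟨U, hU⟩ := hτ.2
      exact ⟨τ, U, fun _ => ⟨(ENNReal.ofReal_lt_ofReal_iff hτ.1).1 htτ, hτ, hU⟩⟩
    · exact ⟨0, 0, fun h => absurd h ht⟩
  choose τ sol hsol using hsol
  -- The value at `t` is taken from a chosen solution living beyond `t`; uniqueness makes the
  -- choices agree.
  let U : ℝ → X := fun t => sol t t
  have huniq : ∀ b V, IsMild S F U₀ (Icc 0 b) V → ∀ t ∈ Icc 0 b, ENNReal.ofReal t < T U₀ →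
      V t = U t := by
    intro b V hV t ht htT
    obtain ⟨h1, -, h3⟩ := hsol t ⟨ht.1, htT⟩
    exact h.eqOn (hV.mono_Icc ht.2) (h3.mono_Icc h1.le) ⟨ht.1, le_rfl⟩
  have hsub : ∀ t, 0 ≤ t ∧ ENNReal.ofReal t < T U₀ → ∀ s ∈ Icc 0 t, ENNReal.ofReal s < T U₀ :=
    fun t ht s hs => (ENNReal.ofReal_le_ofReal hs.2).trans_lt ht.2
  have hUmild : IsMild S F U₀ {t : ℝ | 0 ≤ t ∧ ENNReal.ofReal t < T U₀} U := by
    have hloc : ∀ t, 0 ≤ t ∧ ENNReal.ofReal t < T U₀ → ∀ s, 0 ≤ s ∧ ENNReal.ofReal s < T U₀ →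
        s ≤ τ t → U s = sol t s := fun t ht s hs hst =>
      (huniq _ _ (hsol t ht).2.2 s ⟨hs.1, hst⟩ hs.2).symm
    refine ⟨fun t ht => ?_, fun t ht => ?_⟩
    · obtain ⟨h1, -, h3⟩ := hsol t ht
      have hc : ContinuousWithinAt (sol t) {t : ℝ | 0 ≤ t ∧ ENNReal.ofReal t < T U₀} t := by
        refine (h3.1 t ⟨ht.1, h1.le⟩).mono_of_mem_nhdsWithin ?_
        filter_upwards [self_mem_nhdsWithin, mem_nhdsWithin_of_mem_nhds (Iio_mem_nhds h1)]
          with s hs hs' using ⟨hs.1, le_of_lt hs'⟩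
      refine hc.congr_of_eventuallyEq ?_ (hloc t ht t ht h1.le)
      filter_upwards [self_mem_nhdsWithin, mem_nhdsWithin_of_mem_nhds (Iio_mem_nhds h1)]
        with s hs hs' using hloc t ht s hs (le_of_lt hs')
    · obtain ⟨h1, -, h3⟩ := hsol t ht
      have h4 : IsMild S F U₀ (Icc 0 t) U := by
        refine (h3.mono_Icc h1.le).mono_congr Subset.rfl
          (fun _ hs => ⟨hs.1, Icc_subset_Icc_right hs.2⟩) fun s hs => ?_
        exact hloc t ht s ⟨hs.1, hsub t ht s hs⟩ (hs.2.trans h1.le)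
      exact h4.2 t ⟨ht.1, le_rfl⟩
  refine ⟨U, hUmild, fun b hb hbT V hV t ht => huniq b V hV t ht (hsub b ⟨hb.le, hbT⟩ t ht), ?_⟩
  intro htop
  rw [tendsto_atTop]
  by_contra! hcon
  -- Failure of divergence gives norms below `R` at times arbitrarily close to `T`, while the
  -- existence time `δ` depends on `R` only. Restarting less than `δ` before `T` contradicts its
  -- maximality.
  obtain ⟨R, hR⟩ := hcon
  obtain ⟨δ, hδ, hex⟩ := h.exists_local R
  have hpos : 0 < (T U₀).toReal := ENNReal.toReal_pos (hT U₀).ne' htop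
  have hnear : ∀ᶠ t in 𝓝[<] (T U₀).toReal, t ∈ Ioo (max 0 ((T U₀).toReal - δ)) (T U₀).toReal :=
    Ioo_mem_nhdsLT (max_lt hpos (by linarith))
  obtain ⟨t, htR, ht⟩ := ((not_eventually.1 hR).and_eventually hnear).exists
  have ht0 : 0 ≤ t := (le_max_left _ _).trans ht.1.le
  have htT : ENNReal.ofReal t < T U₀ := (ENNReal.ofReal_lt_iff_lt_toReal ht0 htop).2 ht.2
  obtain ⟨V, hV⟩ := hex (U t) (not_not.1 htR).le
  have hUt : IsMild S F U₀ (Icc 0 t) U :=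
    hUmild.mono_congr (fun s hs => ⟨hs.1, hsub t ⟨ht0, htT⟩ s hs⟩)
      (fun _ hs => ⟨hs.1, Icc_subset_Icc_right hs.2⟩) fun _ _ => rfl
  obtain ⟨W, hW⟩ := h.concat ht0 hδ.le hUt hV
  have hle := hE (U₀ := U₀) (τ := t + δ) ⟨by linarith, W, hW⟩
  have := (ENNReal.ofReal_le_iff_le_toReal htop).1 hle
  have := (le_max_right _ _).trans_lt ht.1
  linarith

end IsSemilinear

end Semilinear

/-! ### Indefinite integrals and integration by parts. -/

section Primitive

/-- `q` is an indefinite integral of the locally integrable function `q'`. -/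
structure IsPrimitive (q q' : ℝ → ℂ) : Prop where
  locallyIntegrable : LocallyIntegrable q' volume
  eq : ∀ x, q x = q 0 + ∫ t in (0 : ℝ)..x, q' t

theorem isPrimitive_integral {g : ℝ → ℂ} (hg : LocallyIntegrable g volume) (c : ℂ) :
    IsPrimitive (fun x => c + ∫ t in (0 : ℝ)..x, g t) g :=
  ⟨hg, fun x => by simp⟩

theorem isPrimitive_of_hasDerivAt {q q' : ℝ → ℂ} (h : ∀ x, HasDerivAt q (q' x) x)
    (hc : Continuous q') : IsPrimitive q q' := by
  refine ⟨hc.locallyIntegrable, fun x => ?_⟩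
  rw [intervalIntegral.integral_eq_sub_of_hasDerivAt (fun y _ => h y)
    (hc.intervalIntegrable _ _)]
  abel

theorem IsPrimitive.intervalIntegrable {q q' : ℝ → ℂ} (h : IsPrimitive q q') (a b : ℝ) :
    IntervalIntegrable q' volume a b :=
  (h.locallyIntegrable.integrableOn_isCompact isCompact_uIcc).intervalIntegrable

theorem IsPrimitive.continuous {q q' : ℝ → ℂ} (h : IsPrimitive q q') : Continuous q := by
  have : Continuous fun x => q 0 + ∫ t in (0 : ℝ)..x, q' t :=
    continuous_const.add (intervalIntegral.continuous_primitive
      h.intervalIntegrable 0)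
  exact this.congr fun x => (h.eq x).symm

theorem IsPrimitive.eq_add {q q' : ℝ → ℂ} (h : IsPrimitive q q') (a x : ℝ) :
    q x = q a + ∫ t in a..x, q' t := by
  have hi := h.intervalIntegrable
  rw [h.eq x, h.eq a, add_assoc, intervalIntegral.integral_add_adjacent_intervals (hi _ _) (hi _ _)]

/-- Indefinite integrals are absolutely continuous, so the product rule integrates although it holds
only almost everywhere. -/
theorem integral_mul_add_mul_of_primitive {f g : ℝ → ℝ} {a b c d : ℝ}
    (hf : IntervalIntegrable f volume a b) (hg : IntervalIntegrable g volume a b) :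
    ∫ x in a..b, (f x * (d + ∫ t in a..x, g t) + (c + ∫ t in a..x, f t) * g x)
      = (c + ∫ t in a..b, f t) * (d + ∫ t in a..b, g t) - c * d := by
  have hconst : ∀ c : ℝ, AbsolutelyContinuousOnInterval (fun _ : ℝ => c) a b := fun c =>
    (LipschitzWith.const c).lipschitzOnWith.absolutelyContinuousOnInterval
  have hF := (hconst c).add
    (hf.absolutelyContinuousOnInterval_intervalIntegral (c := a) left_mem_uIcc)
  have hG := (hconst d).add
    (hg.absolutelyContinuousOnInterval_intervalIntegral (c := a) left_mem_uIcc)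
  have := hF.integral_deriv_mul_eq_sub hG
  simp only [Pi.add_apply, intervalIntegral.integral_same, add_zero] at this
  rw [← this]
  refine intervalIntegral.integral_congr_ae ?_
  filter_upwards [hf.ae_hasDerivAt_integral, hg.ae_hasDerivAt_integral] with x h1 h2 hx
  have hx' := uIoc_subset_uIcc hx
  have e1 : deriv ((fun _ : ℝ => c) + fun x => ∫ t in a..x, f t) x = f x :=
    ((h1 hx' a left_mem_uIcc).const_add c).deriv
  have e2 : deriv ((fun _ : ℝ => d) + fun x => ∫ t in a..x, g t) x = g x :=
    ((h2 hx' a left_mem_uIcc).const_add d).deriv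
  rw [e1, e2]

/-- The real inner product of `ℂ` is the sum of the products of real and of imaginary parts, which
reduces this to the real product rule. -/
theorem IsPrimitive.integral_inner {q q' w w' : ℝ → ℂ} (hq : IsPrimitive q q')
    (hw : IsPrimitive w w') (a b : ℝ) :
    ∫ x in a..b, (inner ℝ (q' x) (w x) + inner ℝ (q x) (w' x))
      = inner ℝ (q b) (w b) - inner ℝ (q a) (w a) := by
  have hiq := hq.intervalIntegrable
  have hiw := hw.intervalIntegrable
  have hre : ∀ {f f' : ℝ → ℂ}, IsPrimitive f f' → ∀ x,
      (f x).re = (f a).re + ∫ t in a..x, (f' t).re := fun {f f'} hf x => by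
    rw [hf.eq_add a x, Complex.add_re]
    congr 1
    exact (Complex.reCLM.intervalIntegral_comp_comm (hf.intervalIntegrable _ _)).symm
  have him : ∀ {f f' : ℝ → ℂ}, IsPrimitive f f' → ∀ x,
      (f x).im = (f a).im + ∫ t in a..x, (f' t).im := fun {f f'} hf x => by
    rw [hf.eq_add a x, Complex.add_im]
    congr 1
    exact (Complex.imCLM.intervalIntegral_comp_comm (hf.intervalIntegrable _ _)).symm
  have ire : ∀ {f : ℝ → ℂ}, IntervalIntegrable f volume a b →
      IntervalIntegrable (fun x => (f x).re) volume a b := fun hf => ⟨hf.1.re, hf.2.re⟩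
  have iim : ∀ {f : ℝ → ℂ}, IntervalIntegrable f volume a b →
      IntervalIntegrable (fun x => (f x).im) volume a b := fun hf => ⟨hf.1.im, hf.2.im⟩
  have h1 := integral_mul_add_mul_of_primitive (c := (q a).re) (d := (w a).re)
    (ire (hiq a b)) (ire (hiw a b))
  have h2 := integral_mul_add_mul_of_primitive (c := (q a).im) (d := (w a).im)
    (iim (hiq a b)) (iim (hiw a b))
  simp only [← hre hq, ← hre hw] at h1
  simp only [← him hq, ← him hw] at h2
  have hinner : ∀ z y : ℂ, inner ℝ z y = z.re * y.re + z.im * y.im := fun z y => by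
    simp [Complex.inner, mul_comm]
  simp only [hinner]
  have hcont := hq.continuous
  have hcont' := hw.continuous
  rw [show (q b).re * (w b).re + (q b).im * (w b).im - ((q a).re * (w a).re + (q a).im * (w a).im)
    = ((q b).re * (w b).re - (q a).re * (w a).re) + ((q b).im * (w b).im - (q a).im * (w a).im) by
      ring, ← h1, ← h2, ← intervalIntegral.integral_add]
  · refine intervalIntegral.integral_congr fun x _ => ?_
    ring
  · exact ((ire (hiq a b)).mul_continuousOn (by fun_prop)).add
      ((ire (hiw a b)).continuousOn_mul (by fun_prop))
  · exact ((iim (hiq a b)).mul_continuousOn (by fun_prop)).add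
      ((iim (hiw a b)).continuousOn_mul (by fun_prop))

/-- Since `k` is integrable, `P` has a limit at infinity; since `P` is integrable, this limit is
`0`. -/
theorem integral_Ioi_eq_neg_of_primitive {P k : ℝ → ℝ} (hP : ∀ x, P x = P 0 + ∫ t in (0 : ℝ)..x, k t)
    (hPi : IntegrableOn P (Ioi 0)) (hk : IntegrableOn k (Ioi 0)) :
    ∫ x in Ioi 0, k x = - P 0 := by
  have h1 : Tendsto P atTop (𝓝 (P 0 + ∫ x in Ioi 0, k x)) :=
    ((intervalIntegral_tendsto_integral_Ioi 0 hk tendsto_id).const_add (P 0)).congr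
      fun x => (hP x).symm
  have h2 : P 0 + ∫ x in Ioi 0, k x = 0 := by
    refine IntegrableAtFilter.eq_zero_of_tendsto (μ := volume)
      ⟨Ioi 0, Ioi_mem_atTop _, hPi⟩ (fun s hs => ?_) h1
    rcases mem_atTop_sets.1 hs with ⟨b, hb⟩
    rw [← top_le_iff, ← Real.volume_Ici (a := b)]
    exact measure_mono hb
  linarith

theorem integral_Iio_eq_of_primitive {P k : ℝ → ℝ} (hP : ∀ x, P x = P 0 + ∫ t in (0 : ℝ)..x, k t)
    (hPi : IntegrableOn P (Iio 0)) (hk : IntegrableOn k (Iio 0)) :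
    ∫ x in Iio 0, k x = P 0 := by
  have hneg : ∀ {g : ℝ → ℝ}, IntegrableOn g (Iio 0) → IntegrableOn (fun x => g (-x)) (Ioi 0) := by
    intro g hg
    have := (Measure.measurePreserving_neg (volume : Measure ℝ)).integrableOn_comp_preimage
      (Homeomorph.neg ℝ).measurableEmbedding (f := g) (s := Iio 0)
    have h2 := this.2 hg
    simpa [Function.comp_def] using h2
  have h1 := integral_Ioi_eq_neg_of_primitive (P := fun x => P (-x)) (k := fun x => - k (-x))
    (fun x => by
      rw [hP (-x), neg_zero, intervalIntegral.integral_neg,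
        intervalIntegral.integral_comp_neg (fun t => k t), intervalIntegral.integral_symm]
      simp) (hneg hPi) (hneg hk).neg
  rw [integral_neg, neg_zero, integral_comp_neg_Ioi, neg_zero, neg_inj] at h1
  rw [← integral_Iic_eq_integral_Iio, h1]

theorem IsPrimitive.inner_eq {q q' w w' : ℝ → ℂ} (hq : IsPrimitive q q')
    (hw : IsPrimitive w w') (x : ℝ) : inner ℝ (q x) (w x) = inner ℝ (q 0) (w 0)
      + ∫ t in (0 : ℝ)..x, (inner ℝ (q' t) (w t) + inner ℝ (q t) (w' t)) := by
  rw [hq.integral_inner hw]; ring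

/-- Integration by parts against a test function. -/
theorem IsPrimitive.integral_deriv_smul {q q' : ℝ → ℂ} (hq : IsPrimitive q q') {φ : ℝ → ℝ}
    (hφ : ContDiff ℝ ∞ φ) (hs : HasCompactSupport φ) :
    ∫ x, deriv φ x • q x = - ∫ x, φ x • q' x := by
  have hd : Continuous (deriv φ) := hφ.continuous_deriv (by simp)
  have i1 : Integrable (fun x => deriv φ x • q x) :=
    hq.continuous.locallyIntegrable.integrable_smul_left_of_hasCompactSupport hd hs.deriv
  have i2 : Integrable (fun x => φ x • q' x) :=
    hq.locallyIntegrable.integrable_smul_left_of_hasCompactSupport hφ.continuous hs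
  have i3 : Integrable (fun x => φ x • q x) :=
    hq.continuous.locallyIntegrable.integrable_smul_left_of_hasCompactSupport hφ.continuous hs
  have i4 : Integrable (fun x => deriv φ x • q x + φ x • q' x) := i1.add i2
  rw [eq_neg_iff_add_eq_zero, ← integral_add i1 i2]
  refine ext_inner_right ℝ fun c => ?_
  rw [inner_zero_left, real_inner_comm, ← _root_.integral_inner i4]
  have hw : IsPrimitive (fun x => φ x • c) (fun x => deriv φ x • c) :=
    isPrimitive_of_hasDerivAt (fun x =>
      ((hφ.differentiable (by simp)).differentiableAt.hasDerivAt).smul_const c) (by fun_prop)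
  have e : ∀ x, inner ℝ c (deriv φ x • q x + φ x • q' x)
      = inner ℝ (q' x) (φ x • c) + inner ℝ (q x) (deriv φ x • c) := fun x => by
    simp only [inner_add_right, real_inner_smul_right, real_inner_comm]
    ring
  have hk : Integrable fun x => inner ℝ (q' x) (φ x • c) + inner ℝ (q x) (deriv φ x • c) :=
    (i4.const_inner c).congr (Eventually.of_forall e)
  have hP : Integrable fun x => inner ℝ (q x) (φ x • c) :=
    (i3.const_inner c).congr (Eventually.of_forall fun x => by
      simp only [real_inner_smul_right, real_inner_comm])
  -- Both half-lines contribute the same boundary term at `0`, with opposite signs.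
  have h1 := integral_Ioi_eq_neg_of_primitive (hq.inner_eq hw) hP.integrableOn hk.integrableOn
  have h2 := integral_Iio_eq_of_primitive (hq.inner_eq hw) hP.integrableOn hk.integrableOn
  rw [integral_congr_ae (Eventually.of_forall e), ← integral_add_compl measurableSet_Ioi hk, h1,
    compl_Ioi, integral_Iic_eq_integral_Iio, h2]
  ring

end Primitive

/-! ### Weak derivatives on intervals and the lemma of du Bois-Reymond. -/

section DuBoisReymond

/-- A test function of mean zero is the derivative of a test function with support in the same
interval. -/
theorem exists_primitive_test {Ω : Set ℝ} (hΩ : Ω.OrdConnected) {ψ : ℝ → ℝ} (h1 : ContDiff ℝ ∞ ψ)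
    (h2 : HasCompactSupport ψ) (h3 : tsupport ψ ⊆ Ω) (h4 : ∫ x, ψ x = 0) :
    ∃ Ψ : ℝ → ℝ, ContDiff ℝ ∞ Ψ ∧ HasCompactSupport Ψ ∧ tsupport Ψ ⊆ Ω ∧ deriv Ψ = ψ := by
  rcases (tsupport ψ).eq_empty_or_nonempty with hne | hne
  · have : ψ = 0 := tsupport_eq_empty_iff.1 hne
    subst this
    exact ⟨0, contDiff_const, HasCompactSupport.zero, by simp [tsupport], by ext; simp⟩
  obtain ⟨a, ha⟩ := h2.isCompact.exists_isLeast hne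
  obtain ⟨b, hb⟩ := h2.isCompact.exists_isGreatest hne
  have hsub : tsupport ψ ⊆ Icc a b := fun x hx => ⟨ha.2 hx, hb.2 hx⟩
  have hzero : ∀ x, x ∉ Icc a b → ψ x = 0 := fun x hx =>
    image_eq_zero_of_notMem_tsupport fun h => hx (hsub h)
  have hder : ∀ x, HasDerivAt (fun x => ∫ t in a..x, ψ t) (ψ x) x := fun x =>
    intervalIntegral.integral_hasDerivAt_right (h1.continuous.intervalIntegrable _ _)
      h1.continuous.stronglyMeasurable.stronglyMeasurableAtFilter h1.continuous.continuousAt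
  have hderiv : deriv (fun x => ∫ t in a..x, ψ t) = ψ := funext fun x => (hder x).deriv
  have hsupp : Function.support (fun x => ∫ t in a..x, ψ t) ⊆ Icc a b := by
    intro x hx
    by_contra hxI
    refine hx ?_
    rcases lt_or_ge x a with hxa | hxa
    · simp only
      rw [intervalIntegral.integral_symm, intervalIntegral.integral_of_le hxa.le, neg_eq_zero,
        integral_Ioc_eq_integral_Ioo]
      exact setIntegral_eq_zero_of_forall_eq_zero fun t ht =>
        hzero t fun h => absurd h.1 (not_le.2 ht.2)
    · have hbx : b < x := not_le.1 fun h => hxI ⟨hxa, h⟩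
      simp only
      rw [intervalIntegral.integral_of_le hxa, ← integral_Icc_eq_integral_Ioc,
        setIntegral_eq_integral_of_forall_compl_eq_zero, h4]
      exact fun t ht => hzero t fun h => ht ⟨h.1, h.2.trans hbx.le⟩
  have htsupp : tsupport (fun x => ∫ t in a..x, ψ t) ⊆ Icc a b :=
    closure_minimal hsupp isClosed_Icc
  refine ⟨_, ?_, HasCompactSupport.intro (isCompact_Icc (a := a) (b := b)) fun x hx => ?_,
    htsupp.trans (hΩ.out (h3 ha.1) (h3 hb.1)), hderiv⟩
  · rw [contDiff_infty_iff_deriv]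
    exact ⟨fun x => (hder x).differentiableAt, by rwa [hderiv]⟩
  · by_contra h
    exact hx (hsupp h)

/-- The lemma of du Bois-Reymond: a function with vanishing weak derivative on an open interval is
constant there. -/
theorem exists_ae_eq_const {Ω : Set ℝ} (hΩ : Ω.OrdConnected) (ho : IsOpen Ω) (hne : Ω.Nonempty)
    {u : ℝ → ℂ} (hu : LocallyIntegrable u volume)
    (h : ∀ φ : ℝ → ℝ, ContDiff ℝ ∞ φ → HasCompactSupport φ → tsupport φ ⊆ Ω →
      ∫ x, deriv φ x • u x = 0) : ∃ c : ℂ, ∀ᵐ x, x ∈ Ω → u x = c := by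
  obtain ⟨x₀, hx₀⟩ := hne
  obtain ⟨r, hr, hrΩ⟩ := Metric.isOpen_iff.1 ho x₀ hx₀
  let β : ContDiffBump x₀ := ⟨r / 4, r / 2, by positivity, by linarith⟩
  let χ : ℝ → ℝ := β.normed volume
  have hχ1 : ContDiff ℝ ∞ χ := β.contDiff_normed
  have hχ2 : HasCompactSupport χ := β.hasCompactSupport_normed
  have hχ3 : tsupport χ ⊆ Ω := by
    rw [β.tsupport_normed_eq]
    exact (Metric.closedBall_subset_ball (by simp only [β]; linarith)).trans hrΩ
  have hχ4 : ∫ x, χ x = 1 := β.integral_normed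
  have hint : ∀ φ : ℝ → ℝ, ContDiff ℝ ∞ φ → HasCompactSupport φ →
      Integrable fun x => φ x • u x := fun φ h1 h2 =>
    hu.integrable_smul_left_of_hasCompactSupport h1.continuous h2
  have hint' : ∀ φ : ℝ → ℝ, ContDiff ℝ ∞ φ → HasCompactSupport φ → Integrable φ :=
    fun φ h1 h2 => h1.continuous.integrable_of_hasCompactSupport h2
  -- The constant is the mean of `u` against a bump `χ` of integral `1`: for any test `φ`, the
  -- function `φ - (∫ φ) χ` has mean zero, hence is the derivative of a test function.
  refine ⟨∫ x, χ x • u x, ?_⟩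
  have key := ho.ae_eq_zero_of_integral_contDiff_smul_eq_zero (μ := volume)
    (f := fun x => u x - ∫ x, χ x • u x)
    ((hu.sub (locallyIntegrable_const _)).locallyIntegrableOn _) (fun φ h1 h2 h3 => ?_)
  · filter_upwards [key] with x hx hxΩ using sub_eq_zero.1 (hx hxΩ)
  set m := ∫ x, φ x
  have hψ2 : HasCompactSupport (fun x => φ x - m * χ x) := h2.sub (hχ2.mul_left (f := fun _ => m))
  obtain ⟨Ψ, k1, k2, k3, k4⟩ := exists_primitive_test hΩ (ψ := fun x => φ x - m * χ x)
    (h1.sub (contDiff_const.mul hχ1)) hψ2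
    ((tsupport_sub _ _).trans (union_subset h3 ((tsupport_mul_subset_right).trans hχ3)))
    (by rw [integral_sub (hint' φ h1 h2) ((hint' χ hχ1 hχ2).const_mul m), integral_const_mul, hχ4,
      mul_one, sub_self])
  have h5 := h Ψ k1 k2 k3
  rw [k4] at h5
  simp only [sub_smul, mul_smul] at h5
  have hsm : Integrable fun x => m • χ x • u x := (hint χ hχ1 hχ2).smul m
  rw [integral_sub (hint φ h1 h2) hsm, integral_smul] at h5
  simp only [smul_sub]
  rw [integral_sub (hint φ h1 h2) ((hint' φ h1 h2).smul_const _), integral_smul_const, h5]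

/-- A function with a weak derivative on an open interval is an indefinite integral there. -/
theorem exists_ae_eq_primitive {Ω : Set ℝ} (hΩ : Ω.OrdConnected) (ho : IsOpen Ω) (hne : Ω.Nonempty)
    {u g : ℝ → ℂ} (hu : LocallyIntegrable u volume) (hg : LocallyIntegrable g volume)
    (h : ∀ φ : ℝ → ℝ, ContDiff ℝ ∞ φ → HasCompactSupport φ → tsupport φ ⊆ Ω →
      ∫ x, deriv φ x • u x = - ∫ x, φ x • g x) :
    ∃ q, IsPrimitive q g ∧ ∀ᵐ x, x ∈ Ω → u x = q x := by
  have hG := isPrimitive_integral hg 0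
  set G : ℝ → ℂ := fun x => 0 + ∫ t in (0 : ℝ)..x, g t
  obtain ⟨c, hc⟩ := exists_ae_eq_const hΩ ho hne (u := fun x => u x - G x)
    (hu.sub hG.continuous.locallyIntegrable) (fun φ h1 h2 h3 => by
      have hd : Continuous (deriv φ) := h1.continuous_deriv (by simp)
      simp only [smul_sub]
      rw [integral_sub (hu.integrable_smul_left_of_hasCompactSupport hd h2.deriv)
        (hG.continuous.locallyIntegrable.integrable_smul_left_of_hasCompactSupport hd h2.deriv),
        h φ h1 h2 h3, hG.integral_deriv_smul h1 h2, sub_self])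
  refine ⟨_, isPrimitive_integral hg c, ?_⟩
  filter_upwards [hc] with x hx hxΩ
  rw [← hx hxΩ]
  simp [G]

end DuBoisReymond

/-! ### Continuous representatives, traces, and functions with a jump at the origin. -/

section Sobolev

theorem locallyIntegrable_L2 (u : L2) : LocallyIntegrable u volume :=
  (Lp.memLp u).locallyIntegrable (by norm_num)

/-- Cauchy–Schwarz on an interval of length `l`. -/
theorem integral_norm_Ioc_le (f : L2) (a : ℝ) {l : ℝ} (hl : 0 ≤ l) :
    ∫ t in Ioc a (a + l), ‖f t‖ ≤ Real.sqrt l * ‖f‖ := by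
  have hf : MemLp f 2 (volume.restrict (Ioc a (a + l))) := (Lp.memLp f).restrict _
  have h1 := eLpNorm_le_eLpNorm_mul_rpow_measure_univ (p := 1) (q := 2)
    (μ := volume.restrict (Ioc a (a + l))) (by norm_num) hf.1
  rw [integral_norm_eq_lintegral_enorm hf.1, ← eLpNorm_one_eq_lintegral_enorm]
  have h2 : eLpNorm f 1 (volume.restrict (Ioc a (a + l)))
      ≤ eLpNorm f 2 volume * (ENNReal.ofReal l) ^ (1 / 2 : ℝ) := by
    refine h1.trans ?_
    have e : (1 / (1 : ℝ≥0∞).toReal - 1 / (2 : ℝ≥0∞).toReal) = (1 / 2 : ℝ) := by norm_num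
    rw [e, Measure.restrict_apply_univ, Real.volume_Ioc, add_sub_cancel_left]
    gcongr
    exact Measure.restrict_le_self
  have h3 := ENNReal.toReal_mono (ENNReal.mul_ne_top (Lp.eLpNorm_ne_top f)
    (ENNReal.rpow_ne_top_of_nonneg (by norm_num) ENNReal.ofReal_ne_top)) h2
  rw [ENNReal.toReal_mul, ← ENNReal.toReal_rpow, ENNReal.toReal_ofReal hl] at h3
  rw [Lp.norm_def, mul_comm, Real.sqrt_eq_rpow]
  exact h3

theorem exists_rep (w : H1) : ∃ g, IsPrimitive g (wderiv w) ∧ fn w =ᵐ[volume] g := by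
  obtain ⟨q, hq, h⟩ := exists_ae_eq_primitive ordConnected_univ isOpen_univ univ_nonempty
    (locallyIntegrable_L2 (fn w)) (locallyIntegrable_L2 (wderiv w)) w.2
  exact ⟨q, hq, by filter_upwards [h] with x hx using hx (mem_univ x)⟩

/-- The continuous representative of an element of `H¹`. -/
noncomputable def rep (w : H1) : ℝ → ℂ := (exists_rep w).choose

theorem isPrimitive_rep (w : H1) : IsPrimitive (rep w) (wderiv w) := (exists_rep w).choose_spec.1

theorem ae_eq_rep (w : H1) : fn w =ᵐ[volume] rep w := (exists_rep w).choose_spec.2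

theorem continuous_rep (w : H1) : Continuous (rep w) := (isPrimitive_rep w).continuous

theorem rep_eq {w : H1} {g : ℝ → ℂ} (hg : Continuous g) (h : fn w =ᵐ[volume] g) : rep w = g :=
  ((continuous_rep w).ae_eq_iff_eq volume hg).1 ((ae_eq_rep w).symm.trans h)

theorem norm_sq_H1 (w : H1) : ‖w‖ ^ 2 = ‖fn w‖ ^ 2 + ‖wderiv w‖ ^ 2 :=
  WithLp.prod_norm_sq_eq_of_L2 w.1

/-- Compare the value at `x` with the values on `(x, x + l]` and average. The free length `l`
matters: a small `l` makes the coefficient of the derivative as small as desired, at the expense of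
the `L²` term. -/
theorem norm_sq_rep_le (w : H1) (x : ℝ) {l : ℝ} (hl : 0 < l) :
    ‖rep w x‖ ^ 2 ≤ 2 * (‖fn w‖ ^ 2 / l + l * ‖wderiv w‖ ^ 2) := by
  have hc := continuous_rep w
  have h1 : ∀ y ∈ Ioc x (x + l), ‖rep w x‖ ≤ ‖rep w y‖ + Real.sqrt l * ‖wderiv w‖ := by
    intro y hy
    have h2 : ‖∫ t in x..y, wderiv w t‖ ≤ Real.sqrt l * ‖wderiv w‖ := by
      rw [intervalIntegral.integral_of_le hy.1.le]
      refine (norm_integral_le_integral_norm _).trans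
        (le_trans ?_ (integral_norm_Ioc_le (wderiv w) x hl.le))
      refine setIntegral_mono_set ?_ (Eventually.of_forall fun _ => norm_nonneg _)
        (Ioc_subset_Ioc_right hy.2).eventuallyLE
      exact (((locallyIntegrable_L2 (wderiv w)).integrableOn_isCompact
        (isCompact_Icc (a := x) (b := x + l))).mono_set Ioc_subset_Icc_self).norm
    have h3 : rep w x = rep w y - ∫ t in x..y, wderiv w t := by
      rw [(isPrimitive_rep w).eq_add x y]; abel
    calc ‖rep w x‖ ≤ ‖rep w y‖ + ‖∫ t in x..y, wderiv w t‖ := by rw [h3]; exact norm_sub_le _ _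
      _ ≤ _ := by gcongr
  have hfin : volume (Ioc x (x + l)) ≠ ⊤ := by simp
  have hi : IntegrableOn (fun y => ‖rep w y‖) (Ioc x (x + l)) :=
    (hc.norm.locallyIntegrable.integrableOn_isCompact isCompact_Icc).mono_set Ioc_subset_Icc_self
  have h4 : l * ‖rep w x‖ ≤ Real.sqrt l * ‖fn w‖ + l * (Real.sqrt l * ‖wderiv w‖) := by
    have h5 := setIntegral_mono_on (integrableOn_const hfin)
      (hi.add (integrableOn_const (C := Real.sqrt l * ‖wderiv w‖) hfin)) measurableSet_Ioc h1
    have h6 : ∫ y in Ioc x (x + l), ‖rep w y‖ ≤ Real.sqrt l * ‖fn w‖ := by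
      refine le_trans (le_of_eq ?_) (integral_norm_Ioc_le (fn w) x hl.le)
      refine setIntegral_congr_ae measurableSet_Ioc ?_
      filter_upwards [ae_eq_rep w] with y hy _
      rw [hy]
    simp only [Pi.add_apply] at h5
    rw [integral_add hi (integrableOn_const hfin), setIntegral_const, setIntegral_const] at h5
    simp only [Real.volume_real_Ioc_of_le (le_add_of_nonneg_right hl.le), add_sub_cancel_left,
      smul_eq_mul] at h5
    linarith
  set s := Real.sqrt l
  have hs : 0 < s := Real.sqrt_pos.2 hl
  have hsl : s * s = l := Real.mul_self_sqrt hl.le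
  have h7 : s * ‖rep w x‖ ≤ ‖fn w‖ + l * ‖wderiv w‖ := by
    refine le_of_mul_le_mul_left ?_ hs
    rw [← mul_assoc, hsl]
    linarith
  have h8 : (s * ‖rep w x‖) ^ 2 ≤ (‖fn w‖ + l * ‖wderiv w‖) ^ 2 := by gcongr
  have h9 : l * ‖rep w x‖ ^ 2 ≤ l * (2 * (‖fn w‖ ^ 2 / l + l * ‖wderiv w‖ ^ 2)) := by
    have e : l * (2 * (‖fn w‖ ^ 2 / l + l * ‖wderiv w‖ ^ 2))
        = 2 * (‖fn w‖ ^ 2 + (l * ‖wderiv w‖) ^ 2) := by field_simp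
    have e' : l * ‖rep w x‖ ^ 2 = (s * ‖rep w x‖) ^ 2 := by rw [mul_pow, sq s, hsl]
    rw [e, e']
    nlinarith [sq_nonneg (‖fn w‖ - l * ‖wderiv w‖)]
  exact le_of_mul_le_mul_left h9 hl

theorem norm_rep_le (w : H1) (x : ℝ) : ‖rep w x‖ ≤ 2 * ‖w‖ := by
  have h := norm_sq_rep_le w x one_pos
  refine le_of_sq_le_sq ?_ (by positivity)
  have := norm_sq_H1 w
  nlinarith [sq_nonneg ‖w‖]

theorem rep_add (u v : H1) : rep (u + v) = rep u + rep v := by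
  refine rep_eq ((continuous_rep u).add (continuous_rep v)) ?_
  exact (Lp.coeFn_add (fn u) (fn v)).trans ((ae_eq_rep u).add (ae_eq_rep v))

theorem rep_smul (c : ℝ) (u : H1) : rep (c • u) = c • rep u := by
  refine rep_eq ((continuous_rep u).const_smul c) ?_
  exact (Lp.coeFn_smul c (fn u)).trans ((ae_eq_rep u).const_smul c)

/-- The value at `0`, as a continuous functional on `H¹`. -/
noncomputable def trace : H1 →L[ℝ] ℂ :=
  LinearMap.mkContinuous
    { toFun := fun w => rep w 0
      map_add' := fun u v => by rw [rep_add]; rfl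
      map_smul' := fun c u => by rw [rep_smul]; rfl } 2 fun w => norm_rep_le w 0

theorem trace_apply (w : H1) : trace w = rep w 0 := rfl

theorem hasValueAtZero_fn (w : H1) : HasValueAtZero (fn w) (trace w) :=
  ⟨rep w, ae_eq_rep w, continuous_rep w, rfl⟩

theorem HasValueAtZero.eq_trace {w : H1} {c : ℂ} (h : HasValueAtZero (fn w) c) : c = trace w := by
  obtain ⟨g, h1, h2, rfl⟩ := h
  rw [trace_apply, rep_eq h2 h1]

/-- The inclusion of `H¹` into `L²`. -/
noncomputable def fnL : H1 →L[ℝ] L2 := (WithLp.fstL 2 ℝ L2 L2).comp H1.subtypeL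

/-- The weak derivative as a continuous operator from `H¹` to `L²`. -/
noncomputable def wderivL : H1 →L[ℝ] L2 := (WithLp.sndL 2 ℝ L2 L2).comp H1.subtypeL

@[simp] theorem fnL_apply (w : H1) : fnL w = fn w := rfl

@[simp] theorem wderivL_apply (w : H1) : wderivL w = wderiv w := rfl

/-- Test functions as elements of `H¹`. -/
theorem exists_test {φ : ℝ → ℝ} (h1 : ContDiff ℝ ∞ φ) (h2 : HasCompactSupport φ) (c : ℂ) :
    ∃ w : H1, fn w =ᵐ[volume] (fun x => φ x • c) ∧ wderiv w =ᵐ[volume] (fun x => deriv φ x • c) ∧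
      trace w = φ 0 • c := by
  have hd : Continuous (deriv φ) := h1.continuous_deriv (by simp)
  have hm : ∀ {ψ : ℝ → ℝ}, Continuous ψ → HasCompactSupport ψ →
      MemLp (fun x => ψ x • c) 2 volume := fun {ψ} hc hs =>
    (hc.smul continuous_const).memLp_of_hasCompactSupport (hs.smul_right (f' := fun _ => c))
  have m1 := hm h1.continuous h2
  have m2 := hm hd h2.deriv
  have hp : IsPrimitive (fun x => φ x • c) (fun x => deriv φ x • c) :=
    isPrimitive_of_hasDerivAt (fun x =>
      ((h1.differentiable (by simp)).differentiableAt.hasDerivAt).smul_const c) (by fun_prop)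
  let w : H1 := ⟨WithLp.toLp 2 (m1.toLp _, m2.toLp _), fun ψ k1 k2 _ => by
    have e1 : ∫ x, deriv ψ x • (m1.toLp _ : L2) x = ∫ x, deriv ψ x • (φ x • c) :=
      integral_congr_ae (by filter_upwards [m1.coeFn_toLp] with x hx; rw [hx])
    have e2 : ∫ x, ψ x • (m2.toLp _ : L2) x = ∫ x, ψ x • (deriv φ x • c) :=
      integral_congr_ae (by filter_upwards [m2.coeFn_toLp] with x hx; rw [hx])
    change ∫ x, deriv ψ x • (m1.toLp _ : L2) x = - ∫ x, ψ x • (m2.toLp _ : L2) x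
    rw [e1, e2]
    exact hp.integral_deriv_smul k1 k2⟩
  have hw : fn w =ᵐ[volume] fun x => φ x • c := m1.coeFn_toLp
  exact ⟨w, hw, m2.coeFn_toLp, by rw [trace_apply, rep_eq hp.continuous hw]⟩

theorem integrable_inner_L2 (f g : L2) : Integrable (fun x => inner ℝ (f x) (g x)) volume :=
  L2.integrable_inner f g

/-- A function with a weak derivative off `0` is an indefinite integral on each side of `0`. -/
theorem exists_primitives {u g : L2} (h : HasWeakDerivOn {0}ᶜ u g) :
    ∃ q r, IsPrimitive q g ∧ IsPrimitive r g ∧ (∀ᵐ x, x ∈ Iio 0 → u x = q x) ∧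
      ∀ᵐ x, x ∈ Ioi 0 → u x = r x := by
  have hl : Iio (0 : ℝ) ⊆ {0}ᶜ := fun x hx => ne_of_lt hx
  have hr : Ioi (0 : ℝ) ⊆ {0}ᶜ := fun x hx => ne_of_gt hx
  obtain ⟨q, hq, hq'⟩ := exists_ae_eq_primitive ordConnected_Iio isOpen_Iio nonempty_Iio
    (locallyIntegrable_L2 u) (locallyIntegrable_L2 g)
    fun φ h1 h2 h3 => h φ h1 h2 (h3.trans hl)
  obtain ⟨r, hr, hr'⟩ := exists_ae_eq_primitive ordConnected_Ioi isOpen_Ioi nonempty_Ioi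
    (locallyIntegrable_L2 u) (locallyIntegrable_L2 g)
    fun φ h1 h2 h3 => h φ h1 h2 (h3.trans hr)
  exact ⟨q, r, hq, hr, hq', hr'⟩

/-- Integration by parts for a function with a jump at `0`. -/
theorem inner_wderiv_add_inner_fn {u g : L2} {q r : ℝ → ℂ} (hq : IsPrimitive q g)
    (hr : IsPrimitive r g) (huq : ∀ᵐ x, x ∈ Iio 0 → u x = q x) (hur : ∀ᵐ x, x ∈ Ioi 0 → u x = r x)
    (w : H1) : inner ℝ u (wderiv w) + inner ℝ g (fn w)
      = inner ℝ (q 0) (trace w) - inner ℝ (r 0) (trace w) := by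
  have hw := isPrimitive_rep w
  have i1 := integrable_inner_L2 u (wderiv w)
  have i2 := integrable_inner_L2 g (fn w)
  have i3 := integrable_inner_L2 u (fn w)
  have hk : Integrable fun x => inner ℝ (u x) (wderiv w x) + inner ℝ (g x) (fn w x) := i1.add i2
  have key : ∀ {p : ℝ → ℂ} {s : Set ℝ}, MeasurableSet s → (∀ᵐ x, x ∈ s → u x = p x) →
      IntegrableOn (fun x => inner ℝ (p x) (rep w x)) s ∧
      IntegrableOn (fun x => inner ℝ (g x) (rep w x) + inner ℝ (p x) (wderiv w x)) s ∧
      ∫ x in s, (inner ℝ (u x) (wderiv w x) + inner ℝ (g x) (fn w x))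
        = ∫ x in s, (inner ℝ (g x) (rep w x) + inner ℝ (p x) (wderiv w x)) := by
    intro p s hs hp
    have hp' := (ae_restrict_iff' hs).2 hp
    have hw' := ae_restrict_of_ae (s := s) (ae_eq_rep w)
    have e : (fun x => inner ℝ (u x) (wderiv w x) + inner ℝ (g x) (fn w x))
        =ᵐ[volume.restrict s] fun x => inner ℝ (g x) (rep w x) + inner ℝ (p x) (wderiv w x) := by
      filter_upwards [hp', hw'] with x h1 h2
      rw [h1, h2, add_comm]
    refine ⟨i3.integrableOn.congr ?_, hk.integrableOn.congr e, integral_congr_ae e⟩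
    filter_upwards [hp', hw'] with x h1 h2
    rw [h1, h2]
  obtain ⟨a1, a2, a3⟩ := key measurableSet_Iio huq
  obtain ⟨b1, b2, b3⟩ := key measurableSet_Ioi hur
  have h1 := integral_Iio_eq_of_primitive (hq.inner_eq hw) a1 a2
  have h2 := integral_Ioi_eq_neg_of_primitive (hr.inner_eq hw) b1 b2
  rw [L2.inner_def, L2.inner_def, ← integral_add i1 i2,
    ← integral_add_compl measurableSet_Ioi hk, compl_Ioi, integral_Iic_eq_integral_Iio, a3, b3,
    h1, h2, trace_apply]
  ring

theorem hasOneSidedValues_of_primitives {u g : L2} {q r : ℝ → ℂ} (hq : IsPrimitive q g)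
    (hr : IsPrimitive r g) (huq : ∀ᵐ x, x ∈ Iio 0 → u x = q x)
    (hur : ∀ᵐ x, x ∈ Ioi 0 → u x = r x) : HasOneSidedValues u (q 0) (r 0) := by
  have e1 : ∀ x < 0, (if x < 0 then q x else r x) = q x := fun x hx => if_pos hx
  have e2 : ∀ x > 0, (if x < 0 then q x else r x) = r x := fun x hx => if_neg (not_lt.2 hx.le)
  refine ⟨fun x => if x < 0 then q x else r x, ?_, ?_, ?_, ?_⟩
  · filter_upwards [huq, hur, Measure.ae_ne volume (0 : ℝ)] with x h1 h2 h3
    rcases lt_or_gt_of_ne h3 with hx | hx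
    · rw [e1 x hx, h1 hx]
    · rw [e2 x hx, h2 hx]
  · intro x hx
    refine ContinuousAt.continuousWithinAt ?_
    rcases lt_or_gt_of_ne hx with hx | hx
    · exact hq.continuous.continuousAt.congr (by
        filter_upwards [Iio_mem_nhds hx] with y hy using (e1 y hy).symm)
    · exact hr.continuous.continuousAt.congr (by
        filter_upwards [Ioi_mem_nhds hx] with y hy using (e2 y hy).symm)
  · exact ((hq.continuous.tendsto 0).mono_left nhdsWithin_le_nhds).congr' (by
      filter_upwards [self_mem_nhdsWithin] with y hy using (e1 y hy).symm)
  · exact ((hr.continuous.tendsto 0).mono_left nhdsWithin_le_nhds).congr' (by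
      filter_upwards [self_mem_nhdsWithin] with y hy using (e2 y hy).symm)

theorem HasOneSidedValues.unique {u : L2} {a b a' b' : ℂ} (h : HasOneSidedValues u a b)
    (h' : HasOneSidedValues u a' b') : a = a' ∧ b = b' := by
  obtain ⟨g, h1, h2, h3, h4⟩ := h
  obtain ⟨k, k1, k2, k3, k4⟩ := h'
  have heq : EqOn g k {0}ᶜ := Measure.eqOn_open_of_ae_eq (μ := volume)
    (ae_restrict_of_ae (h1.symm.trans k1)) isOpen_compl_singleton h2 k2
  refine ⟨tendsto_nhds_unique (h3.congr' ?_) k3, tendsto_nhds_unique (h4.congr' ?_) k4⟩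
  · filter_upwards [self_mem_nhdsWithin] with x hx using heq (ne_of_lt hx)
  · filter_upwards [self_mem_nhdsWithin] with x hx using heq (ne_of_gt hx)

end Sobolev

/-! ### Bounded bilinear forms and Lax–Milgram. -/

section Forms

variable {V G : Type*} [NormedAddCommGroup V] [InnerProductSpace ℝ V] [NormedAddCommGroup G]
  [InnerProductSpace ℝ G]

/-- The bounded bilinear form `(x, y) ↦ ⟪P x, Q y⟫`. -/
noncomputable def innerForm (P Q : V →L[ℝ] G) : V →L[ℝ] V →L[ℝ] ℝ :=
  LinearMap.mkContinuous₂
    (LinearMap.mk₂ ℝ (fun x y => inner ℝ (P x) (Q y))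
      (fun x y z => by rw [map_add, inner_add_left])
      (fun c x y => by rw [map_smul, real_inner_smul_left, smul_eq_mul])
      (fun x y z => by rw [map_add, inner_add_right])
      (fun c x y => by rw [map_smul, real_inner_smul_right, smul_eq_mul])) (‖P‖ * ‖Q‖)
    fun x y => by
      refine (norm_inner_le_norm _ _).trans ?_
      calc ‖P x‖ * ‖Q y‖ ≤ (‖P‖ * ‖x‖) * (‖Q‖ * ‖y‖) :=
            mul_le_mul (P.le_opNorm x) (Q.le_opNorm y) (norm_nonneg _) (by positivity)
        _ = ‖P‖ * ‖Q‖ * ‖x‖ * ‖y‖ := by ring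

@[simp] theorem innerForm_apply (P Q : V →L[ℝ] G) (x y : V) :
    innerForm P Q x y = inner ℝ (P x) (Q y) := rfl

/-- The Lax–Milgram theorem for bounded functionals. -/
theorem exists_forall_eq_of_isCoercive [CompleteSpace V] {B : V →L[ℝ] V →L[ℝ] ℝ} (hB : IsCoercive B)
    (f : V →L[ℝ] ℝ) : ∃ u, ∀ w, B u w = f w := by
  obtain ⟨u, hu⟩ := hB.continuousLinearEquivOfBilin.surjective
    ((InnerProductSpace.toDual ℝ V).symm f)
  refine ⟨u, fun w => ?_⟩
  rw [← hB.continuousLinearEquivOfBilin_apply, hu, InnerProductSpace.toDual_symm_apply]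

end Forms

/-! ### The Klein–Gordon operator: weak form, energy estimate and resolvent equation. -/

section Operator

theorem eq_zero_of_integral_smul_eq_zero {Ω : Set ℝ} (hΩ : IsOpen Ω) (hΩ' : ∀ᵐ x, x ∈ Ω) {g : L2}
    (h : ∀ φ : ℝ → ℝ, ContDiff ℝ ∞ φ → HasCompactSupport φ → tsupport φ ⊆ Ω →
      ∫ x, φ x • g x = 0) : g = 0 := by
  rw [Lp.eq_zero_iff_ae_eq_zero]
  filter_upwards [hΩ.ae_eq_zero_of_integral_contDiff_smul_eq_zero
    ((locallyIntegrable_L2 g).locallyIntegrableOn _) h, hΩ'] with x hx hxΩ using hx hxΩ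

theorem fn_injective : Function.Injective fn := by
  have h0 : ∀ w : H1, fn w = 0 → w = 0 := by
    intro w hw
    have : wderiv w = 0 := eq_zero_of_integral_smul_eq_zero isOpen_univ (by simp)
      fun φ h1 h2 h3 => by
        have h4 : ∫ x, deriv φ x • fn w x = - ∫ x, φ x • wderiv w x := w.2 φ h1 h2 h3
        rw [← neg_eq_zero, ← h4, hw, ← integral_zero ℝ ℂ]
        refine integral_congr_ae ?_
        filter_upwards [Lp.coeFn_zero ℂ 2 (volume : Measure ℝ)] with x hx
        rw [hx]; simp
    have h5 := norm_sq_H1 w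
    rw [hw, this] at h5
    simpa using h5
  intro u v huv
  have h1 : fn u = fn v := huv
  refine sub_eq_zero.1 (h0 _ ?_)
  rw [← fnL_apply, map_sub, fnL_apply, fnL_apply, h1, sub_self]

/-- Translates between real inner products in `L²` and `ℂ`-valued integrals against test functions;
letting `c` vary recovers the complex identity. -/
theorem inner_of_ae_eq_smul {g k : L2} {ψ : ℝ → ℝ} {c : ℂ} (hk : k =ᵐ[volume] fun x => ψ x • c)
    (hi : Integrable fun x => ψ x • g x) :
    inner ℝ g k = inner ℝ (∫ x, ψ x • g x) c := by
  rw [real_inner_comm c, ← _root_.integral_inner hi, L2.inner_def]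
  refine integral_congr_ae ?_
  filter_upwards [hk] with x hx
  rw [hx, real_inner_smul_right, real_inner_smul_right, real_inner_comm]

variable (m γ α : ℝ)

/-- The weak form of `W = 𝒜 U`, for `(U, W) = ((u, v), (v, u'' - m² u))`: the derivative jump is
encoded by testing with functions in `H¹(ℝ)`. -/
noncomputable def weakForm (P : Energy × Energy) (φ : H1) : ℝ :=
  inner ℝ (wderiv P.1.fst) (wderiv φ) + inner ℝ (P.2.snd + m ^ 2 • fn P.1.fst) (fn φ)
    + inner ℝ (γ * trace P.1.fst + Complex.I * α * trace P.2.fst) (trace φ)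

theorem weakForm_add (P Q : Energy × Energy) (φ : H1) :
    weakForm m γ α (P + Q) φ = weakForm m γ α P φ + weakForm m γ α Q φ := by
  simp only [weakForm, Prod.fst_add, Prod.snd_add, WithLp.add_fst, WithLp.add_snd, ← fnL_apply,
    ← wderivL_apply, map_add, smul_add, mul_add, inner_add_left]
  ring

theorem weakForm_smul (c : ℝ) (P : Energy × Energy) (φ : H1) :
    weakForm m γ α (c • P) φ = c * weakForm m γ α P φ := by
  have e : (γ * (c • trace P.1.fst) + Complex.I * α * (c • trace P.2.fst) : ℂ)
      = c • (γ * trace P.1.fst + Complex.I * α * trace P.2.fst) := by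
    simp only [Complex.real_smul]; ring
  simp only [weakForm, Prod.smul_fst, Prod.smul_snd, WithLp.smul_fst, WithLp.smul_snd, ← fnL_apply,
    ← wderivL_apply, map_smul, smul_comm (m ^ 2) c, ← smul_add, e, real_inner_smul_left]
  ring

/-- The graph of `𝒜` in weak form. -/
noncomputable def weakGraph : Submodule ℝ (Energy × Energy) where
  carrier := {P | fn P.2.fst = P.1.snd ∧ ∀ φ, weakForm m γ α P φ = 0}
  zero_mem' := ⟨rfl, fun φ => by
    have := weakForm_smul m γ α 0 0 φ
    simpa using this⟩
  add_mem' := fun {P Q} hP hQ => ⟨by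
    rw [← fnL_apply] at *
    simp only [Prod.fst_add, Prod.snd_add, WithLp.add_fst, WithLp.add_snd, map_add]
    rw [fnL_apply, fnL_apply, hP.1, hQ.1], fun φ => by
    rw [weakForm_add, hP.2, hQ.2, add_zero]⟩
  smul_mem' := fun c P hP => ⟨by
    rw [← fnL_apply] at *
    simp only [Prod.smul_fst, Prod.smul_snd, WithLp.smul_fst, WithLp.smul_snd, map_smul]
    rw [fnL_apply, hP.1], fun φ => by
    rw [weakForm_smul, hP.2, mul_zero]⟩

theorem generatorGraph_subset_weakGraph :
    generatorGraph m γ α ⊆ (weakGraph m γ α : Set (Energy × Energy)) := by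
  rintro ⟨U, W⟩ ⟨⟨-, -, a, b, c, d, hab, hc, hd, hjump⟩, hW, u'', hu'', hW2⟩
  simp only at hab hc hd hW hu'' hW2
  refine ⟨hW, fun φ => ?_⟩
  obtain ⟨q, r, hq, hr, h1, h2⟩ := exists_primitives hu''
  -- The one-sided values in the jump condition are those of the primitives of `u''` on the two
  -- half-lines, so they are the boundary terms of the integration by parts.
  obtain ⟨rfl, rfl⟩ := hab.unique (hasOneSidedValues_of_primitives hq hr h1 h2)
  rw [← hW] at hd
  rw [hc.eq_trace, hd.eq_trace] at hjump
  have h3 := inner_wderiv_add_inner_fn hq hr h1 h2 φ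
  have h4 : W.snd + m ^ 2 • fn U.fst = u'' := by rw [hW2]; abel
  simp only [weakForm]
  rw [h4, h3, ← hjump, inner_sub_left]
  ring

theorem weakGraph_subset_generatorGraph :
    (weakGraph m γ α : Set (Energy × Energy)) ⊆ generatorGraph m γ α := by
  rintro ⟨U, W⟩ ⟨hW, h⟩
  simp only [weakForm] at hW h
  set g : L2 := W.snd + m ^ 2 • fn U.fst with hg
  -- Test functions supported off `0` have zero trace, so the boundary term disappears and the weak
  -- equation remains.
  have hweak : HasWeakDerivOn {0}ᶜ (wderiv U.fst) g := by
    intro φ h1 h2 h3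
    have hd : Continuous (deriv φ) := h1.continuous_deriv (by simp)
    have i1 := integrable_smul_L2 (deriv φ) hd h2.deriv (wderiv U.fst)
    have i2 := integrable_smul_L2 φ h1.continuous h2 g
    have hφ0 : φ 0 = 0 := image_eq_zero_of_notMem_tsupport fun h0 => h3 h0 rfl
    rw [eq_neg_iff_add_eq_zero]
    refine ext_inner_right ℝ fun c => ?_
    obtain ⟨w, hw1, hw2, hw3⟩ := exists_test h1 h2 c
    have := h w
    rw [hw3, hφ0, zero_smul, inner_zero_right, add_zero, inner_of_ae_eq_smul hw2 i1,
      inner_of_ae_eq_smul hw1 i2] at this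
    rw [inner_add_left, inner_zero_left, this]
  obtain ⟨q, r, hq, hr, h1, h2⟩ := exists_primitives hweak
  have hd : HasValueAtZero U.snd (trace W.fst) := by
    have := hasValueAtZero_fn W.fst
    rwa [hW] at this
  refine ⟨⟨⟨g, hweak⟩, ⟨W.fst, hW⟩, q 0, r 0, trace U.fst, trace W.fst,
    hasOneSidedValues_of_primitives hq hr h1 h2, hasValueAtZero_fn _, hd, ?_⟩, hW, g, hweak, ?_⟩
  -- A bump equal to `1` at `0`, multiplied by an arbitrary `c`, isolates the boundary term and
  -- hence the jump condition.
  · refine ext_inner_right ℝ fun c => ?_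
    let β : ContDiffBump (0 : ℝ) := ⟨1, 2, one_pos, one_lt_two⟩
    obtain ⟨w, -, -, hw⟩ := exists_test β.contDiff β.hasCompactSupport c
    have hβ : β 0 = 1 := β.one_of_mem_closedBall (by simp [β])
    rw [hβ, one_smul] at hw
    have h3 := h w
    rw [inner_wderiv_add_inner_fn hq hr h1 h2 w, hw] at h3
    rw [inner_sub_left]
    linarith
  · simp [hg]

theorem generatorGraph_eq : generatorGraph m γ α = weakGraph m γ α :=
  (generatorGraph_subset_weakGraph m γ α).antisymm (weakGraph_subset_generatorGraph m γ α)

/-- The size of the `L²` term that compensates the form `γ |u(0)|²`. -/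
noncomputable def massBound : ℝ := 8 * |γ| * (|γ| + 1) + 1 / 2

/-- The trace inequality with `l = 1 / (4 (|γ| + 1))` bounds `|γ| |u(0)|²` by `‖u'‖² / 2 + 8 |γ|
(|γ| + 1) ‖u‖²`. This dictates `massBound`, whose summand `1 / 2` leaves half of the `L²` norm
squared. -/
theorem half_norm_sq_le {M : ℝ} (hM : massBound γ ≤ M) (u : H1) :
    1 / 2 * ‖u‖ ^ 2 ≤ ‖wderiv u‖ ^ 2 + M * ‖fn u‖ ^ 2 + γ * ‖trace u‖ ^ 2 := by
  have hpos : 0 < 4 * (|γ| + 1) := by positivity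
  have h1 := norm_sq_rep_le u 0 (l := 1 / (4 * (|γ| + 1))) (by positivity)
  rw [← trace_apply, div_div_eq_mul_div, div_one] at h1
  have h2 : |γ| * (1 / (4 * (|γ| + 1))) ≤ 1 / 4 := by
    rw [mul_one_div, div_le_iff₀ hpos]; linarith [abs_nonneg γ]
  have h3 : -(|γ| * ‖trace u‖ ^ 2) ≤ γ * ‖trace u‖ ^ 2 := by
    rw [← neg_mul]; gcongr; exact neg_abs_le γ
  have h4 := mul_le_mul_of_nonneg_left h1 (abs_nonneg γ)
  have h5 := mul_le_mul_of_nonneg_right h2 (sq_nonneg ‖wderiv u‖)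
  have h6 := mul_le_mul_of_nonneg_right hM (sq_nonneg ‖fn u‖)
  rw [norm_sq_H1]
  unfold massBound at h6
  linarith

/-- The energy, as a bilinear form which is equivalent to the inner product. -/
noncomputable def energyForm : Energy →L[ℝ] Energy →L[ℝ] ℝ :=
  innerForm (wderivL.comp (WithLp.fstL 2 ℝ H1 L2)) (wderivL.comp (WithLp.fstL 2 ℝ H1 L2))
  + massBound γ • innerForm (fnL.comp (WithLp.fstL 2 ℝ H1 L2)) (fnL.comp (WithLp.fstL 2 ℝ H1 L2))
  + γ • innerForm (trace.comp (WithLp.fstL 2 ℝ H1 L2)) (trace.comp (WithLp.fstL 2 ℝ H1 L2))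
  + innerForm (WithLp.sndL 2 ℝ H1 L2) (WithLp.sndL 2 ℝ H1 L2)

theorem energyForm_apply (U V : Energy) : energyForm γ U V =
    inner ℝ (wderiv U.fst) (wderiv V.fst) + massBound γ * inner ℝ (fn U.fst) (fn V.fst)
      + γ * inner ℝ (trace U.fst) (trace V.fst) + inner ℝ U.snd V.snd := rfl

theorem le_energyForm (U : Energy) :
    1 / 2 * ‖U.fst‖ ^ 2 + ‖U.snd‖ ^ 2 ≤ energyForm γ U U := by
  have := half_norm_sq_le γ le_rfl U.fst
  rw [energyForm_apply]
  simp only [real_inner_self_eq_norm_sq]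
  linarith

/-- The form of the stationary problem `(l - 𝒜) U = Z`, reduced to the first component. -/
noncomputable def stationaryForm (l : ℝ) : H1 →L[ℝ] H1 →L[ℝ] ℝ :=
  innerForm wderivL wderivL + (l ^ 2 + m ^ 2) • innerForm fnL fnL
    + innerForm (((γ : ℂ) + Complex.I * α * l) • trace) trace

theorem inner_I_mul_self (c : ℝ) (z : ℂ) : inner ℝ (Complex.I * c * z) z = 0 := by
  simp [Complex.inner]
  ring

theorem inner_ofReal_mul (c : ℝ) (z w : ℂ) : inner ℝ (c * z) w = c * inner ℝ z w := by
  rw [← Complex.real_smul, real_inner_smul_left]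

/-- The summand `iα l` is skew for the real inner product and drops out on the diagonal. -/
theorem isCoercive_stationaryForm {l : ℝ} (hl : massBound γ ≤ l ^ 2 + m ^ 2) :
    IsCoercive (stationaryForm m γ α l) := by
  refine ⟨1 / 2, by norm_num, fun u => ?_⟩
  have h1 := half_norm_sq_le γ hl u
  have h2 : stationaryForm m γ α l u u = ‖wderiv u‖ ^ 2 + (l ^ 2 + m ^ 2) * ‖fn u‖ ^ 2
      + inner ℝ (((γ : ℂ) + Complex.I * α * l) * trace u) (trace u) := by
    rw [← real_inner_self_eq_norm_sq, ← real_inner_self_eq_norm_sq]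
    rfl
  have h3 : ((γ : ℂ) + Complex.I * α * l) * trace u
      = γ * trace u + Complex.I * (α * l : ℝ) * trace u := by push_cast; ring
  rw [h2, h3, inner_add_left, inner_I_mul_self, inner_ofReal_mul, real_inner_self_eq_norm_sq]
  linarith

/-- Eliminating `v = l u - Z₁` and `W₂ = l v - Z₂` from the weak form leaves one equation for `u`,
with form `stationaryForm` and a right-hand side that contains the trace of `Z₁`. -/
theorem weakGraph_surj {l : ℝ} (hl : massBound γ ≤ l ^ 2 + m ^ 2) (Z : Energy) :
    ∃ U W, (U, W) ∈ weakGraph m γ α ∧ l • U - W = Z := by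
  obtain ⟨u, hu⟩ := exists_forall_eq_of_isCoercive (isCoercive_stationaryForm m γ α hl)
    ((innerSL ℝ (Z.snd + l • fn Z.fst)).comp fnL
      + (innerSL ℝ (Complex.I * α * trace Z.fst)).comp trace)
  refine ⟨WithLp.toLp 2 (u, fn (l • u - Z.fst)),
    WithLp.toLp 2 (l • u - Z.fst, l • fn (l • u - Z.fst) - Z.snd), ⟨rfl, fun φ => ?_⟩, ?_⟩
  · have h := hu φ
    have h1 : inner ℝ (wderiv u) (wderiv φ) + (l ^ 2 + m ^ 2) * inner ℝ (fn u) (fn φ)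
        + inner ℝ (((γ : ℂ) + Complex.I * α * l) * trace u) (trace φ)
        = inner ℝ (Z.snd + l • fn Z.fst) (fn φ)
          + inner ℝ (Complex.I * α * trace Z.fst) (trace φ) := h
    have h2 : l • fn (l • u - Z.fst) - Z.snd + m ^ 2 • fn u
        = (l ^ 2 + m ^ 2) • fn u - (Z.snd + l • fn Z.fst) := by
      simp only [← fnL_apply, map_sub, map_smul]
      module
    have h3 : γ * trace u + Complex.I * α * trace (l • u - Z.fst)
        = ((γ : ℂ) + Complex.I * α * l) * trace u - Complex.I * α * trace Z.fst := by
      simp only [map_sub, map_smul, Complex.real_smul]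
      ring
    change inner ℝ (wderiv u) (wderiv φ)
      + inner ℝ (l • fn (l • u - Z.fst) - Z.snd + m ^ 2 • fn u) (fn φ)
      + inner ℝ (γ * trace u + Complex.I * α * trace (l • u - Z.fst)) (trace φ) = 0
    rw [h2, h3, inner_sub_left, inner_sub_left, real_inner_smul_left]
    linarith
  · refine WithLp.ofLp_injective 2 (Prod.ext ?_ ?_)
    · change l • u - (l • u - Z.fst) = Z.fst
      abel
    · change l • fn (l • u - Z.fst) - (l • fn (l • u - Z.fst) - Z.snd) = Z.snd
      abel

theorem weakGraph_single_valued (W : Energy) (h : (0, W) ∈ weakGraph m γ α) : W = 0 := by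
  obtain ⟨h1, h2⟩ := h
  have h3 : W.fst = 0 := fn_injective h1
  have h4 : W.snd = 0 := by
    refine eq_zero_of_integral_smul_eq_zero isOpen_univ (by simp) fun φ k1 k2 _ => ?_
    refine ext_inner_right ℝ fun c => ?_
    obtain ⟨w, hw, -, -⟩ := exists_test k1 k2 c
    rw [← inner_of_ae_eq_smul hw (integrable_smul_L2 φ k1.continuous k2 _), inner_zero_left]
    have h5 : inner ℝ (0 : L2) (wderiv w) + inner ℝ (W.snd + m ^ 2 • (0 : L2)) (fn w)
        + inner ℝ (γ * trace 0 + Complex.I * α * trace W.fst) (trace w) = 0 := h2 w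
    simpa [h3] using h5
  exact WithLp.ofLp_injective 2 (Prod.ext h3 h4)

/-- Testing the weak form with `W.fst`, that is with `v`, cancels the gradient and `γ` terms of the
energy pairing, and the `α` term is skew. Only `(massBound γ - m²) (u, v)` survives, which the
energy controls. -/
theorem isQuasiDissipative_weakGraph :
    IsQuasiDissipative (weakGraph m γ α) (energyForm γ)
      (|massBound γ - m ^ 2| + massBound γ + 1) := by
  have hM : 0 ≤ massBound γ := by unfold massBound; positivity
  refine ⟨by positivity, ⟨1 / 2, by norm_num, fun U => ?_⟩, fun U V => ?_, fun U W h => ?_,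
    fun l hl Z => weakGraph_surj m γ α ?_ Z, weakGraph_single_valued m γ α⟩
  · have h1 := le_energyForm γ U
    have h2 := WithLp.prod_norm_sq_eq_of_L2 U
    nlinarith [sq_nonneg ‖U.snd‖]
  · simp only [energyForm_apply, real_inner_comm]
  · have h1 : fn W.fst = U.snd := h.1
    have h2 : inner ℝ (wderiv U.fst) (wderiv W.fst)
        + inner ℝ (W.snd + m ^ 2 • fn U.fst) (fn W.fst)
        + inner ℝ (γ * trace U.fst + Complex.I * α * trace W.fst) (trace W.fst) = 0 := h.2 W.fst
    rw [inner_add_left, inner_add_left, real_inner_smul_left, inner_I_mul_self, inner_ofReal_mul,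
      h1, real_inner_comm U.snd W.snd] at h2
    have h3 : energyForm γ U W = (massBound γ - m ^ 2) * inner ℝ (fn U.fst) U.snd := by
      rw [energyForm_apply, h1]
      linarith
    have h4 : (massBound γ - m ^ 2) * inner ℝ (fn U.fst) U.snd
        ≤ |massBound γ - m ^ 2| * (‖fn U.fst‖ * ‖U.snd‖) := by
      refine (le_abs_self _).trans ?_
      rw [abs_mul]
      gcongr
      exact abs_real_inner_le_norm _ _
    have h5 : ‖fn U.fst‖ * ‖U.snd‖ ≤ energyForm γ U U := by
      have h6 := le_energyForm γ U
      rw [norm_sq_H1] at h6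
      nlinarith [sq_nonneg (‖fn U.fst‖ - ‖U.snd‖), sq_nonneg ‖wderiv U.fst‖, sq_nonneg ‖U.snd‖]
    have h7 : 0 ≤ energyForm γ U U := le_trans (by positivity) h5
    have h8 := mul_le_mul_of_nonneg_left h5 (abs_nonneg (massBound γ - m ^ 2))
    rw [h3]
    nlinarith
  -- The summands `massBound γ + 1` of the dissipativity constant are there for the range condition:
  -- they force `l² ≥ massBound γ`.
  · have h1 : massBound γ + 1 < l := by linarith [abs_nonneg (massBound γ - m ^ 2)]
    nlinarith [sq_nonneg m]

end Operator

/-! ### The nonlinearity is Lipschitz on balls of the energy space. -/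

section Nonlinearity

variable {p Cf : ℝ} {f : ℂ → ℂ}

theorem lipschitz_on_ball (hp : 1 ≤ p) (hCf : 0 < Cf) (hfLip : ∀ z w : ℂ,
      ‖f z - f w‖ ≤ Cf * (1 + ‖z‖ ^ (p - 1) + ‖w‖ ^ (p - 1)) * ‖z - w‖) {R : ℝ} {z w : ℂ}
    (hz : ‖z‖ ≤ R) (hw : ‖w‖ ≤ R) :
    ‖f z - f w‖ ≤ Cf * (1 + R ^ (p - 1) + R ^ (p - 1)) * ‖z - w‖ := by
  have hp' : 0 ≤ p - 1 := sub_nonneg.2 hp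
  refine (hfLip z w).trans ?_
  gcongr

theorem ae_norm_fn_le (u : H1) : ∀ᵐ x, ‖fn u x‖ ≤ 2 * ‖u‖ := by
  filter_upwards [ae_eq_rep u] with x hx
  rw [hx]
  exact norm_rep_le u x

/-- As `u` is bounded and `f 0 = 0`, the Lipschitz bound against `w = 0` gives `|f(u)| ≤ C |u|`
almost everywhere. -/
theorem memLp_comp_fn (hp : 1 ≤ p) (hCf : 0 < Cf) (hf : Continuous f) (hf0 : f 0 = 0)
    (hfLip : ∀ z w : ℂ,
      ‖f z - f w‖ ≤ Cf * (1 + ‖z‖ ^ (p - 1) + ‖w‖ ^ (p - 1)) * ‖z - w‖) (u : H1) :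
    MemLp (fun x => f (fn u x)) 2 volume := by
  refine (Lp.memLp (fn u)).of_le_mul
    (c := Cf * (1 + (2 * ‖u‖) ^ (p - 1) + (2 * ‖u‖) ^ (p - 1)))
    (hf.comp_aestronglyMeasurable (Lp.memLp (fn u)).1) ?_
  filter_upwards [ae_norm_fn_le u] with x hx
  have := lipschitz_on_ball hp hCf hfLip hx (w := 0) (by simp)
  rwa [hf0, sub_zero, sub_zero] at this

/-- On the ball of radius `R` the first components are bounded pointwise by `2 R`, so the Lipschitz
constant of `f` on that disc passes to the `L²` norm. -/
theorem norm_nonlinearity_sub_le (hp : 1 ≤ p) (hCf : 0 < Cf) (hf : Continuous f) (hf0 : f 0 = 0)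
    (hfLip : ∀ z w : ℂ,
      ‖f z - f w‖ ≤ Cf * (1 + ‖z‖ ^ (p - 1) + ‖w‖ ^ (p - 1)) * ‖z - w‖) (R : ℝ) :
    ∃ L, ∀ U V, ‖U‖ ≤ R → ‖V‖ ≤ R →
      ‖nonlinearity f U - nonlinearity f V‖ ≤ L * ‖U - V‖ := by
  rcases lt_or_ge R 0 with hR | hR
  · exact ⟨0, fun U V hU _ => absurd (norm_nonneg U) (by linarith)⟩
  set L := Cf * (1 + (2 * R) ^ (p - 1) + (2 * R) ^ (p - 1))
  have hL0 : 0 ≤ L := by positivity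
  have hfst : ∀ U : Energy, ‖U.fst‖ ≤ ‖U‖ := fun U => by
    have := WithLp.prod_norm_sq_eq_of_L2 U
    exact le_of_sq_le_sq (by nlinarith [sq_nonneg ‖U.snd‖]) (norm_nonneg _)
  have hfn : ∀ u : H1, ‖fn u‖ ≤ ‖u‖ := fun u => by
    have := norm_sq_H1 u
    exact le_of_sq_le_sq (by nlinarith [sq_nonneg ‖wderiv u‖]) (norm_nonneg _)
  refine ⟨L, fun U V hU hV => ?_⟩
  have mU := memLp_comp_fn hp hCf hf hf0 hfLip U.fst
  have mV := memLp_comp_fn hp hCf hf hf0 hfLip V.fst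
  have e : nonlinearity f U - nonlinearity f V
      = WithLp.toLp 2 ((0 : H1), mU.toLp _ - mV.toLp _) := by
    rw [nonlinearity, nonlinearity, dif_pos mU, dif_pos mV, ← WithLp.toLp_sub, Prod.mk_sub_mk,
      sub_zero]
  have e2 : ‖nonlinearity f U - nonlinearity f V‖ = ‖(mU.toLp _ - mV.toLp _ : L2)‖ := by
    rw [e, WithLp.prod_norm_eq_of_L2]
    simp
  rw [e2]
  have h1 : ‖(mU.toLp _ - mV.toLp _ : L2)‖ ≤ L * ‖fn U.fst - fn V.fst‖ := by
    refine Lp.norm_le_mul_norm_of_ae_le_mul ?_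
    filter_upwards [ae_norm_fn_le U.fst, ae_norm_fn_le V.fst, mU.coeFn_toLp, mV.coeFn_toLp,
      Lp.coeFn_sub (mU.toLp _) (mV.toLp _), Lp.coeFn_sub (fn U.fst) (fn V.fst)]
      with x hxU hxV hx1 hx2 hx3 hx4
    rw [hx3, hx4, Pi.sub_apply, Pi.sub_apply, hx1, hx2]
    exact lipschitz_on_ball hp hCf hfLip
      (hxU.trans (mul_le_mul_of_nonneg_left ((hfst U).trans hU) zero_le_two))
      (hxV.trans (mul_le_mul_of_nonneg_left ((hfst V).trans hV) zero_le_two))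
  refine h1.trans (mul_le_mul_of_nonneg_left ?_ hL0)
  calc ‖fn U.fst - fn V.fst‖ = ‖fn (U - V).fst‖ := by
        rw [WithLp.sub_fst, ← fnL_apply (U.fst - V.fst), map_sub]; rfl
    _ ≤ ‖U - V‖ := (hfn _).trans (hfst _)

end Nonlinearity

end DeltaKG

theorem theorem2p11 (m γ α : ℝ) (hm : 0 < m) (p Cf : ℝ) (hp : 1 ≤ p) (hCf : 0 < Cf)
    (f : ℂ → ℂ) (hf : Continuous f) (hf0 : f 0 = 0)
    (hfLip : ∀ z w : ℂ,
      ‖f z - f w‖ ≤ Cf * (1 + ‖z‖ ^ (p - 1) + ‖w‖ ^ (p - 1)) * ‖z - w‖) :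
    -- the map `F(u, v) = (0, f(u))` is well defined on the energy space
    (∀ u : DeltaKG.H1, MemLp (fun x => f (DeltaKG.fn u x)) 2 volume) ∧
    -- the operator `𝒜` generates a unique strongly continuous semigroup `S(t) = exp(t𝒜)`
    ∃ S : ℝ≥0 → DeltaKG.Energy →L[ℝ] DeltaKG.Energy,
      DeltaKG.IsSemigroupGeneratedBy S (DeltaKG.generatorGraph m γ α) ∧
      (∀ S' : ℝ≥0 → DeltaKG.Energy →L[ℝ] DeltaKG.Energy,
        DeltaKG.IsSemigroupGeneratedBy S' (DeltaKG.generatorGraph m γ α) → S' = S) ∧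
      -- the Cauchy problem
      ∃ T : DeltaKG.Energy → ℝ≥0∞, (∀ U₀, 0 < T U₀) ∧
        ∀ U₀ : DeltaKG.Energy, ∃ U : ℝ → DeltaKG.Energy,
          DeltaKG.IsMildSolution S f U₀ {t : ℝ | 0 ≤ t ∧ ENNReal.ofReal t < T U₀} U ∧
          (∀ τ : ℝ, 0 < τ → ENNReal.ofReal τ < T U₀ → ∀ V : ℝ → DeltaKG.Energy,
            DeltaKG.IsMildSolution S f U₀ (Icc 0 τ) V → EqOn V U (Icc 0 τ)) ∧
          (T U₀ ≠ ⊤ → Tendsto (fun t => ‖U t‖) (𝓝[<] (T U₀).toReal) atTop) := by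
  have hqd := DeltaKG.isQuasiDissipative_weakGraph m γ α
  obtain ⟨S, hS⟩ := hqd.exists_semigroup
  have hsl : DeltaKG.IsSemilinear S (DeltaKG.nonlinearity f) :=
    ⟨hS.map_zero, hS.map_add, hS.continuous_uncurry, hS.locally_bounded,
      DeltaKG.norm_nonlinearity_sub_le hp hCf hf hf0 hfLip⟩
  -- `IsMildSolution` unfolds to `IsMild` for this nonlinearity, so the abstract result applies as
  -- it stands.
  refine ⟨DeltaKG.memLp_comp_fn hp hCf hf hf0 hfLip, S, ?_, ?_, hsl.exists_maximal⟩
  · rw [DeltaKG.generatorGraph_eq]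
    exact hS
  · intro S' hS'
    rw [DeltaKG.generatorGraph_eq] at hS'
    exact hS.unique hS' hqd.dense_domain
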